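/- Let $n\ge 1$ and let $p_1\ge p_2\ge\dots\ge p_n\ge 0$ be real weights, padded by $p_t=0$ for $t>n$; put $W_m=\sum_{t>m}p_t$. A one-ended code is a binary prefix-free code $v_1,\dots,v_n$ all of whose words end in $1$; its cost is $\sum_t p_t|v_t|$, and it is optimal if its cost is minimum. In a binary tree (left edges $0$, right edges $1$; the level of a node is its number of edges to the root, and $\ell(T)$ is the maximum level), a node other than the root is a $0$-node or a $1$-node according to the edge to its parent; the words of a code label $1$-leaves of the tree. **1 (Structure).** There are a tree $T^*$ and an optimal one-ended code $v_1,\dots,v_n$ labelling $n$ distinct $1$-leaves of $T^*$, with $|v_1|\le\dots\le|v_n|$ and no unlabelled $1$-leaf of smaller depth than a labelled one, such that with $\ell=\ell(T^*)$: (a) $T^*$ is full (each internal node has two children); (b) all internal $1$-nodes are on levels $<\ell-1$; (c) all $0$-leaves are on level $\ell$; (d) at most $n-1$ $1$-leaves are on levels $<\ell$; (e) at most $n-1$ internal $0$-nodes are on level $\ell-1$. For every labelled tree with these properties (whether or not its cost is minimum) and every $i\le\ell$, the number of unlabelled ("bad") nodes on level $i$ is at most $2n-1$, and for $n\ge2$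 and $i=\ell$ it is at most $2n-2$. **2 (Dynamic program).** An $i$-level tree with signature $(m,b)$ is a full binary tree with all nodes on levels $\le i$ in which $m$ distinct $1$-leaves $v_1,\dots,v_m$, of nondecreasing depth, are labelled, all leaves on levels $<i$ are labelled, and exactly $b$ nodes on level $i$ are unlabelled. Its $i$-level partial cost is $\sum_{t\le m}p_t\,\mathrm{depth}(v_t)+i\sum_{m<t\le n}p_t$. For a valid signature $(m,b)$, that is, $0\le m\le n$ and $0\le b\le 2n-1$, let $OPT[m,b]$ be the minimum of the partial costs over all $i$ and all $i$-level trees with signature $(m,b)$ ($\infty$ if there are none; otherwise the minimum is attained). For valid signatures write $(m',b')\to(m,b)$ if $m'\le m$, $m=m'+2b'-b$ and $1\le b'\le b\le 2b'$. Then $OPT[0,1]=0$, and for every valid $(m,b)\ne(0,1)$ $$OPT[m,b]=\min_{(m',b')\to(m,b)}\bigl(OPT[m',b']+W_{m'}\bigr)\qquad(\min\emptyset=\infty).$$ The cost of an optimal one-ended code is $\min_{1\le b\le 2n-1}OPT[n,b]$, and for $n\ge2$ it is also $\min_{1\le b\le 2n-2}OPT[n,b]$. **3 (Batching).** For $d\ge2$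 and $1\le b'\le d/2$ let $\gamma(b')=OPT[d-2b',b']+W_{d-2b'}$. For every valid $(m,b)$ with $b>0$ and $m+b=d$, $$OPT[m,b]=\min\{\gamma(b') : b/2\le b'\le b,\ b'\le d/2\}.$$ **4 (Running time).** There is one program (the same for all $n$ and $p$) for a word RAM, with words of value $O(n^2)$, unit-cost word operations, and unit-cost addition and comparison of real numbers and $\infty$, which on every input $n\ge1$, $p_1\ge\dots\ge p_n\ge0$ halts after $O(n^2)$ steps having computed all entries $OPT[m,b]$ with $(m,b)$ valid, the cost of an optimal one-ended code, and a sequence $(0,1)=(m_0,b_0)\to(m_1,b_1)\to\dots\to(m_\ell,b_\ell)$ with $m_\ell=n$ such that some $\ell$-level tree labelled by an optimal one-ended code has, for every $i\le\ell$, exactly $m_i$ labelled leaves on levels $\le i$ and $b_i$ unlabelled nodes on level $i$. -/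

import Mathlib

namespace OneEnded

/-! ### Codes -/

/-- The word `w` ends with the character `c` (`true` is the character 1, `false` is 0). -/
def EndsIn (c : Bool) (w : List Bool) : Prop := ∃ u, w = u ++ [c]

/-- A binary prefix-free code with `n` words, all ending with a 1. -/
def IsOneEndedCode {n : ℕ} (v : Fin n → List Bool) : Prop :=
  (∀ t, EndsIn true (v t)) ∧ ∀ s t, s ≠ t → ¬ v s <+: v t

/-- The cost `∑ pₜ |vₜ|`. -/
noncomputable def cost {n : ℕ} (p : Fin n → ℝ) (v : Fin n → List Bool) : ℝ :=
  ∑ t, p t * ((v t).length : ℝ)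

/-- A minimum-cost one-ended code for the weights `p`. -/
def IsOptimalCode {n : ℕ} (p : Fin n → ℝ) (v : Fin n → List Bool) : Prop :=
  IsOneEndedCode v ∧ ∀ w : Fin n → List Bool, IsOneEndedCode w → cost p v ≤ cost p w

/-! ### Binary trees; a node is the word read on the path from the root to it -/

/-- A finite rooted binary tree (an internal node may have one or two children). -/
structure CodeTree where
  nodes : Finset (List Bool)
  root_mem : [] ∈ nodes
  parent_mem : ∀ w c, w ++ [c] ∈ nodes → w ∈ nodes

namespace CodeTree

def IsLeaf (T : CodeTree) (w : List Bool) : Prop :=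
  w ∈ T.nodes ∧ ∀ c, w ++ [c] ∉ T.nodes

def IsInternal (T : CodeTree) (w : List Bool) : Prop :=
  w ∈ T.nodes ∧ ∃ c, w ++ [c] ∈ T.nodes

/-- Every internal node has two children. -/
def Full (T : CodeTree) : Prop := ∀ w, T.IsInternal w → ∀ c, w ++ [c] ∈ T.nodes

/-- The level of the tree: the maximum level of a node. -/
def height (T : CodeTree) : ℕ := T.nodes.sup List.length

/-- `v` labels distinct 1-leaves of `T` in order of nondecreasing depth. -/
structure Labels (T : CodeTree) {m : ℕ} (v : Fin m → List Bool) : Prop where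
  injective : Function.Injective v
  isLeaf : ∀ t, T.IsLeaf (v t)
  endsIn : ∀ t, EndsIn true (v t)
  sorted : ∀ s t, s ≤ t → (v s).length ≤ (v t).length

open Classical in
/-- The number of bad nodes on level `j`: the nodes that carry no label. -/
noncomputable def badAt (T : CodeTree) {m : ℕ} (v : Fin m → List Bool) (j : ℕ) : ℕ :=
  (T.nodes.filter (fun w => w.length = j ∧ w ∉ Set.range v)).card

open Classical in
/-- The structural conditions (a)-(e) on a one-ended tree for `n` words, of level `ℓ`. -/
structure Structural (T : CodeTree) (n : ℕ) : Prop where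
  /-- (a) The tree is full. -/
  full : T.Full
  /-- (b) All 1-internals are on levels `< ℓ - 1`. -/
  oneInternal : ∀ w, T.IsInternal w → EndsIn true w → w.length + 1 < T.height
  /-- (c) All 0-leaves are on level `ℓ`. -/
  zeroLeaf : ∀ w, T.IsLeaf w → EndsIn false w → w.length = T.height
  /-- (d) At most `n - 1` 1-leaves are on levels `< ℓ`. -/
  card_oneLeaf : (T.nodes.filter
    (fun w => T.IsLeaf w ∧ EndsIn true w ∧ w.length < T.height)).card ≤ n - 1
  /-- (e) At most `n - 1` 0-internals are on level `ℓ - 1`. -/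
  card_zeroInternal : (T.nodes.filter
    (fun w => T.IsInternal w ∧ EndsIn false w ∧ w.length + 1 = T.height)).card ≤ n - 1

end CodeTree

/-! ### Partial trees, signatures and the dynamic program -/

/-- An `i`-level tree with `m` good 1-leaves, the labelled ones: a full tree with all nodes on
levels `≤ i`, in which every bad node above level `i` has been made internal. -/
structure PartialTree (i m : ℕ) where
  tree : CodeTree
  v : Fin m → List Bool
  full : tree.Full
  length_le : ∀ w ∈ tree.nodes, w.length ≤ i
  labels : tree.Labels v
  good_of_lt : ∀ w, tree.IsLeaf w → w.length < i → w ∈ Set.range v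

/-- The second component `b` of the `i`-level signature `(m, b)`. -/
noncomputable def PartialTree.bad {i m : ℕ} (T : PartialTree i m) : ℕ := T.tree.badAt T.v i

/-- The `i`-level partial cost `∑_{t ≤ m} depth(vₜ) pₜ + i ∑_{m < t ≤ n} pₜ`. -/
noncomputable def PartialTree.partialCost {i m n : ℕ} (T : PartialTree i m)
    (p : Fin n → ℝ) : ℝ :=
  ∑ t : Fin n, p t * (if h : t.val < m then ((T.v ⟨t.val, h⟩).length : ℝ) else (i : ℝ))

/-- `OPT[m, b]`: the minimum `i`-level partial cost over all `i` and all `i`-level trees with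
signature `(m, b)`, and `∞` if there is no such tree. -/
noncomputable def OPT {n : ℕ} (p : Fin n → ℝ) (m b : ℕ) : EReal :=
  ⨅ (i : ℕ) (T : PartialTree i m) (_ : T.bad = b), (T.partialCost p : EReal)

/-- `W_m = ∑_{t > m} pₜ`; the weight `pₜ` is `p ⟨t - 1, _⟩`. -/
noncomputable def W {n : ℕ} (p : Fin n → ℝ) (m : ℕ) : ℝ :=
  ∑ t : Fin n, if m ≤ t.val then p t else 0

/-- Valid signatures. -/
def Valid (n : ℕ) (q : ℕ × ℕ) : Prop := q.1 ≤ n ∧ q.2 ≤ 2 * n - 1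

/-- The expansion relation `(m', b') → (m, b)` on valid signatures. -/
def Expands (n : ℕ) (q' q : ℕ × ℕ) : Prop :=
  Valid n q' ∧ Valid n q ∧ q'.1 ≤ q.1 ∧ q.1 + q.2 = q'.1 + 2 * q'.2 ∧
    1 ≤ q'.2 ∧ q'.2 ≤ q.2 ∧ q.2 ≤ 2 * q'.2

/-- `γ(b') = OPT[d - 2b', b'] + W_{d - 2b'}`, used for `2b' ≤ d` only. -/
noncomputable def gamma {n : ℕ} (p : Fin n → ℝ) (d b' : ℕ) : EReal :=
  OPT p (d - 2 * b') b' + (W p (d - 2 * b') : EReal)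

/-! ### The machine: a word RAM with unit-cost addition and comparison of reals

A program uses finitely many word registers, word arrays and real arrays.  Arrays are indexed
by words.  A word is a natural number of at most a bound `B`; an operation whose result
exceeds `B` has no successor state.  A cell of a real array holds a real number or `∞`. -/

structure State where
  reg : ℕ → ℕ
  word : ℕ → ℕ → ℕ
  real : ℕ → ℕ → EReal

def State.setReg (s : State) (x k : ℕ) : State :=
  { s with reg := Function.update s.reg x k }

def State.setWord (s : State) (a i k : ℕ) : State :=
  { s with word := Function.update s.word a (Function.update (s.word a) i k) }

noncomputable def State.setReal (s : State) (a i : ℕ) (r : EReal) : State :=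
  { s with real := Function.update s.real a (Function.update (s.real a) i r) }

/-- The instructions.  `x y z` are registers, `k` is a constant, `a b c` are arrays. -/
inductive Instr where
  /-- `x := k` -/
  | const (x k : ℕ)
  /-- `x := y` -/
  | move (x y : ℕ)
  /-- `x := y + z` -/
  | add (x y z : ℕ)
  /-- `x := max (y - z) 0` -/
  | sub (x y z : ℕ)
  /-- `x := y * z` -/
  | mul (x y z : ℕ)
  /-- `x := a[y]`, a word array -/
  | load (x a y : ℕ)
  /-- `a[x] := y`, a word array -/
  | store (a x y : ℕ)
  /-- `a[x] := 0`, a real array -/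
  | realZero (a x : ℕ)
  /-- `a[x] := ∞`, a real array -/
  | realInf (a x : ℕ)
  /-- `a[x] := b[y]`, real arrays -/
  | realMove (a x b y : ℕ)
  /-- `a[x] := b[y] + c[z]`, real arrays -/
  | realAdd (a x b y c z : ℕ)

/-- The effect of an instruction when words are bounded by `B`. -/
inductive Step (B : ℕ) : Instr → State → State → Prop
  | const (s : State) (x k : ℕ) (h : k ≤ B) : Step B (.const x k) s (s.setReg x k)
  | move (s : State) (x y : ℕ) : Step B (.move x y) s (s.setReg x (s.reg y))
  | add (s : State) (x y z : ℕ) (h : s.reg y + s.reg z ≤ B) :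
      Step B (.add x y z) s (s.setReg x (s.reg y + s.reg z))
  | sub (s : State) (x y z : ℕ) :
      Step B (.sub x y z) s (s.setReg x (s.reg y - s.reg z))
  | mul (s : State) (x y z : ℕ) (h : s.reg y * s.reg z ≤ B) :
      Step B (.mul x y z) s (s.setReg x (s.reg y * s.reg z))
  | load (s : State) (x a y : ℕ) : Step B (.load x a y) s (s.setReg x (s.word a (s.reg y)))
  | store (s : State) (a x y : ℕ) :
      Step B (.store a x y) s (s.setWord a (s.reg x) (s.reg y))
  | realZero (s : State) (a x : ℕ) : Step B (.realZero a x) s (s.setReal a (s.reg x) 0)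
  | realInf (s : State) (a x : ℕ) : Step B (.realInf a x) s (s.setReal a (s.reg x) ⊤)
  | realMove (s : State) (a x b y : ℕ) :
      Step B (.realMove a x b y) s (s.setReal a (s.reg x) (s.real b (s.reg y)))
  | realAdd (s : State) (a x b y c z : ℕ) :
      Step B (.realAdd a x b y c z) s
        (s.setReal a (s.reg x) (s.real b (s.reg y) + s.real c (s.reg z)))

/-- The tests `x < y` on registers and `a[x] ≤ b[y]` on real arrays. -/
inductive Test where
  | lt (x y : ℕ)
  | realLe (a x b y : ℕ)

def Test.Holds : Test → State → Prop
  | .lt x y, s => s.reg x < s.reg y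
  | .realLe a x b y, s => s.real a (s.reg x) ≤ s.real b (s.reg y)

inductive Prog where
  | nop
  | instr (i : Instr)
  | seq (P Q : Prog)
  | ite (c : Test) (P Q : Prog)
  | loop (c : Test) (P : Prog)

/-- `Exec B P s t s'`: with words bounded by `B`, program `P` started in state `s` halts in
state `s'` after exactly `t` steps; every instruction and every test is one step. -/
inductive Exec (B : ℕ) : Prog → State → ℕ → State → Prop
  | nop (s : State) : Exec B .nop s 1 s
  | instr {i : Instr} {s s' : State} (h : Step B i s s') : Exec B (.instr i) s 1 s'
  | seq {P Q : Prog} {s s' s'' : State} {t t' : ℕ}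
      (h : Exec B P s t s') (h' : Exec B Q s' t' s'') : Exec B (.seq P Q) s (t + t') s''
  | iteTrue {c : Test} {P Q : Prog} {s s' : State} {t : ℕ}
      (hc : c.Holds s) (h : Exec B P s t s') : Exec B (.ite c P Q) s (t + 1) s'
  | iteFalse {c : Test} {P Q : Prog} {s s' : State} {t : ℕ}
      (hc : ¬ c.Holds s) (h : Exec B Q s t s') : Exec B (.ite c P Q) s (t + 1) s'
  | loopTrue {c : Test} {P : Prog} {s s' s'' : State} {t t' : ℕ}
      (hc : c.Holds s) (h : Exec B P s t s') (h' : Exec B (.loop c P) s' t' s'') :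
      Exec B (.loop c P) s (t + t' + 1) s''
  | loopFalse {c : Test} {P : Prog} {s : State} (hc : ¬ c.Holds s) : Exec B (.loop c P) s 1 s

/-- The input: `n` in register 0 and the weights in cells `0, …, n - 1` of real array 0;
everything else is 0. -/
noncomputable def initState {n : ℕ} (p : Fin n → ℝ) : State where
  reg := fun x => if x = 0 then n else 0
  word := fun _ _ => 0
  real := fun a j => if h : a = 0 ∧ j < n then ((p ⟨j, h.2⟩ : ℝ) : EReal) else 0

open Classical in
/-- The output: the whole table `OPT[m, b]` in real array 1, row by row with rows of length
`2n`; the optimal cost in cell 0 of real array 2; and the signatures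
`(m₀, b₀) → (m₁, b₁) → ⋯ → (m_ℓ, b_ℓ)` of the truncations to levels `0, …, ℓ` of a
minimum-cost tree, with `ℓ` in register 0, the `mᵢ` in word array 0 and the `bᵢ` in word
array 1. -/
def IsOutput {n : ℕ} (p : Fin n → ℝ) (s : State) : Prop :=
  (∀ m b, Valid n (m, b) → s.real 1 (m * (2 * n) + b) = OPT p m b) ∧
  ∃ T : PartialTree (s.reg 0) n, IsOptimalCode p T.v ∧
    s.real 2 0 = (cost p T.v : EReal) ∧
    (∀ i ≤ s.reg 0,
      s.word 0 i = (Finset.univ.filter (fun t => (T.v t).length ≤ i)).card ∧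
      s.word 1 i = T.tree.badAt T.v i) ∧
    s.word 0 0 = 0 ∧ s.word 1 0 = 1 ∧ s.word 0 (s.reg 0) = n ∧
    ∀ i < s.reg 0, Expands n (s.word 0 i, s.word 1 i) (s.word 0 (i + 1), s.word 1 (i + 1))

end OneEnded

namespace OneEnded

/-! ### Words and trees -/

/-! Structure. Among the codes costing no more than a given one, take one of least total length and
sort it. Its tree consists of the words of length at most `l`, the greatest code length, that
properly extend no code word. An internal 1-node on level `l - 1` could itself replace a code word
of length `l`, which contradicts minimality; this is (b). Since some word has length `l`, at most `n
- 1` words are shorter, which gives (d), and also (e), because the 1-sibling of a 0-internal on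
level `l - 1` is such a shorter word. Conversely, under (a)-(e) the bad nodes on level `l - 1` are
0-internals (or the root), so level `l` has at most twice `n - 1` bad nodes; bad nodes never become
fewer from one level to the next, because each has a bad 0-child. See `exists_structural`,
`badAt_height_le`, `badAt_le`.

Dynamic program. In an `i`-level tree all leaves above level `i` are labelled, so one more level
means that each of the `b'` bad nodes on level `i` gets two children and `m - m'` of the 1-children
get labels. Each weight beyond the first `m'` pays one more unit, `W_{m'}` in total. Cutting off and
adding a level (`exists_truncate`, `exists_extend`) give the two inequalities of the recurrence
`OPT_eq_iInf`. As `m + b` grows strictly with the level, a signature bounds the level and the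
minimum is attained. Every code is dominated by a structured one whose signature lies in the allowed
range, so the row `m = n` yields the optimum, and its existence.

Batching. On the diagonal `m + b = d` the predecessor is determined by `b'`, and `m' ≤ m` reads `b /
2 ≤ b'`. The entries are therefore minima of one function of `b'` over windows from `⌈b / 2⌉` to
`b`. Cut the indices into blocks of equal binary logarithm: such a window is a suffix of one block
together with a prefix of the same or the next block (`min_suffixMin_prefixMin`). Prefix and suffix
minima take `O(n)` steps per diagonal, and there are `3n` diagonals.

Machine. Loop-free code is verified by weakest preconditions (`haltsIn_of_pre`), loops by an
invariant and a variant (`haltsIn_loop`). A linear scan finds a minimizing predecessor; at most `3n`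
scans lead from the best entry of row `n` back to `(0, 1)`, and `exists_tree_of_chain` turns the
reversed sequence into an optimal tree. -/

theorem endsIn_concat {c c' : Bool} {u : List Bool} : EndsIn c (u ++ [c']) ↔ c = c' := by
  constructor
  · rintro ⟨w, hw⟩
    exact ((List.append_inj' hw rfl).2 |> List.singleton_inj.1).symm
  · rintro rfl
    exact ⟨u, rfl⟩

theorem not_endsIn_nil {c : Bool} : ¬ EndsIn c [] := by
  rintro ⟨w, hw⟩
  simp at hw

namespace CodeTree

theorem mem_of_prefix {T : CodeTree} {u w : List Bool} (h : u <+: w) (hw : w ∈ T.nodes) :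
    u ∈ T.nodes := by
  obtain ⟨x, rfl⟩ := h
  induction x using List.reverseRecOn with
  | nil => simpa using hw
  | append_singleton x c ih =>
    rw [← List.append_assoc] at hw
    exact ih (T.parent_mem _ _ hw)

theorem isInternal_of_not_isLeaf {T : CodeTree} {w : List Bool} (hw : w ∈ T.nodes)
    (h : ¬ T.IsLeaf w) : T.IsInternal w := by
  refine ⟨hw, ?_⟩
  by_contra! hc
  exact h ⟨hw, hc⟩

theorem Labels.not_mem_range_of_isInternal {T : CodeTree} {m : ℕ} {v : Fin m → List Bool}
    (hv : T.Labels v) {w : List Bool} (hw : T.IsInternal w) : w ∉ Set.range v := by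
  rintro ⟨t, rfl⟩
  obtain ⟨c, hc⟩ := hw.2
  exact (hv.isLeaf t).2 c hc

open Classical in
-- A bad node on level `j` is internal, so its 0-child exists by fullness; that child is bad because
-- labels end in 1.
theorem badAt_le_succ {T : CodeTree} {m : ℕ} {v : Fin m → List Bool} (hT : T.Full)
    (hv : T.Labels v) {j : ℕ}
    (hj : ∀ w ∈ T.nodes, w.length = j → w ∉ Set.range v → T.IsInternal w) :
    T.badAt v j ≤ T.badAt v (j + 1) := by
  unfold badAt
  refine Finset.card_le_card_of_injOn (fun w => w ++ [false]) ?_ ?_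
  · intro w hw
    simp only [Finset.coe_filter, Set.mem_ofPred_eq] at hw ⊢
    refine ⟨hT w (hj w hw.1 hw.2.1 hw.2.2) false, by simp [hw.2.1], ?_⟩
    rintro ⟨t, ht⟩
    have := hv.endsIn t
    rw [ht, endsIn_concat] at this
    simp at this
  · intro w _ w' _ h
    simpa using h

open Classical in
-- Labelled nodes are leaves, so the nodes on level `j + 1` are exactly the children, two each, of
-- the bad nodes on level `j`.
theorem badAt_succ {T : CodeTree} {m : ℕ} {v : Fin m → List Bool} (hT : T.Full)
    (hv : T.Labels v) {j : ℕ}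
    (hj : ∀ w ∈ T.nodes, w.length = j → w ∉ Set.range v → T.IsInternal w) :
    T.badAt v (j + 1) + (Finset.univ.filter fun t => (v t).length = j + 1).card
      = 2 * T.badAt v j := by
  have hlab : (Finset.univ.filter fun t => (v t).length = j + 1).card =
      ((T.nodes.filter fun w => w.length = j + 1).filter fun w => w ∈ Set.range v).card := by
    rw [← Finset.card_image_of_injective _ hv.injective]
    congr 1
    ext w
    simp only [Finset.mem_image, Finset.mem_filter, Finset.mem_univ, true_and, Set.mem_range]
    constructor
    · rintro ⟨t, ht, rfl⟩
      exact ⟨⟨(hv.isLeaf t).1, ht⟩, t, rfl⟩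
    · rintro ⟨⟨_, h⟩, t, rfl⟩
      exact ⟨t, h, rfl⟩
  have hbad : T.badAt v (j + 1) =
      ((T.nodes.filter fun w => w.length = j + 1).filter fun w => ¬ w ∈ Set.range v).card := by
    rw [badAt, Finset.filter_filter]
  have hall : (T.nodes.filter fun w => w.length = j + 1) =
      ((T.nodes.filter (fun w => w.length = j ∧ w ∉ Set.range v)) ×ˢ
        (Finset.univ : Finset Bool)).image (fun x => x.1 ++ [x.2]) := by
    ext w
    simp only [Finset.mem_image, Finset.mem_filter, Finset.mem_product, Finset.mem_univ,
      and_true, Prod.exists]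
    constructor
    · rintro ⟨hw, hl⟩
      rcases List.eq_nil_or_concat w with rfl | ⟨u, c, rfl⟩
      · simp at hl
      · have hu := T.parent_mem u c (by simpa using hw)
        refine ⟨u, c, ⟨hu, by simpa using hl, ?_⟩, by simp⟩
        exact hv.not_mem_range_of_isInternal ⟨hu, c, by simpa using hw⟩
    · rintro ⟨u, c, ⟨hu, hl, hr⟩, rfl⟩
      exact ⟨hT u (hj u hu hl hr) c, by simp [hl]⟩
  rw [hlab, hbad, add_comm, Finset.card_filter_add_card_filter_not, hall,
    Finset.card_image_of_injective, Finset.card_product, badAt]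
  · simp [mul_comm]
  · rintro ⟨u, c⟩ ⟨u', c'⟩ h
    have := List.append_inj' h rfl
    simp at this
    simp [this]

open Classical in
theorem badAt_zero {T : CodeTree} {m : ℕ} {v : Fin m → List Bool} (hv : T.Labels v) :
    T.badAt v 0 = 1 := by
  unfold badAt
  rw [Finset.card_eq_one]
  refine ⟨[], ?_⟩
  ext w
  simp only [Finset.mem_filter, List.length_eq_zero_iff, Finset.mem_singleton]
  refine ⟨fun h => h.2.1, ?_⟩
  rintro rfl
  refine ⟨T.root_mem, rfl, ?_⟩
  rintro ⟨t, ht⟩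
  exact not_endsIn_nil (ht ▸ hv.endsIn t)

theorem Labels.isOneEndedCode {T : CodeTree} {m : ℕ} {v : Fin m → List Bool}
    (hv : T.Labels v) : IsOneEndedCode v := by
  refine ⟨hv.endsIn, ?_⟩
  rintro s t hst ⟨x, hx⟩
  cases x with
  | nil => exact hst (hv.injective (by simpa using hx))
  | cons c x =>
    refine (hv.isLeaf s).2 c (mem_of_prefix ⟨x, ?_⟩ (hv.isLeaf t).1)
    simpa using hx

end CodeTree

/-! ### Growing and truncating partial trees -/

namespace PartialTree

variable {i m : ℕ}

theorem isInternal (T : PartialTree i m) {w : List Bool} (hw : w ∈ T.tree.nodes)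
    (hi : w.length < i) (hr : w ∉ Set.range T.v) : T.tree.IsInternal w :=
  CodeTree.isInternal_of_not_isLeaf hw fun h => hr (T.good_of_lt w h hi)

theorem length_v_le (T : PartialTree i m) (t : Fin m) : (T.v t).length ≤ i :=
  T.length_le _ (T.labels.isLeaf t).1

theorem badAt_le_succ (T : PartialTree i m) {j : ℕ} (hj : j < i) :
    T.tree.badAt T.v j ≤ T.tree.badAt T.v (j + 1) :=
  CodeTree.badAt_le_succ T.full T.labels fun _ hw hl => T.isInternal hw (hl ▸ hj)

theorem badAt_succ (T : PartialTree i m) {j : ℕ} (hj : j < i) :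
    T.tree.badAt T.v (j + 1) + (Finset.univ.filter fun t => (T.v t).length = j + 1).card
      = 2 * T.tree.badAt T.v j :=
  CodeTree.badAt_succ T.full T.labels fun _ hw hl => T.isInternal hw (hl ▸ hj)

theorem one_le_badAt (T : PartialTree i m) {j : ℕ} (hj : j ≤ i) :
    1 ≤ T.tree.badAt T.v j := by
  induction j with
  | zero => rw [CodeTree.badAt_zero T.labels]
  | succ j ih => exact (ih (by omega)).trans (T.badAt_le_succ hj)

theorem badAt_le_bad (T : PartialTree i m) {j : ℕ} (hj : j ≤ i) :
    T.tree.badAt T.v j ≤ T.bad := by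
  obtain ⟨k, rfl⟩ := Nat.exists_eq_add_of_le hj
  unfold bad
  have : ∀ x ≤ k, T.tree.badAt T.v j ≤ T.tree.badAt T.v (j + x) := by
    intro x
    induction x with
    | zero => simp
    | succ x ih =>
      intro hx
      exact (ih (by omega)).trans (T.badAt_le_succ (by omega))
  exact this k le_rfl

/-- `T` arises from `T'` by one more level. -/
structure Extends {m' : ℕ} (T : PartialTree (i + 1) m) (T' : PartialTree i m') : Prop where
  le : m' ≤ m
  badAt : ∀ j ≤ i, T.tree.badAt T.v j = T'.tree.badAt T'.v j
  length : ∀ (t : Fin m) (h : t.val < m'), (T.v t).length = (T'.v ⟨t, h⟩).length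
  length' : ∀ t : Fin m, m' ≤ t.val → (T.v t).length = i + 1

open Classical in
theorem exists_truncate (T : PartialTree (i + 1) m) :
    ∃ (m' : ℕ) (T' : PartialTree i m'), T.Extends T' := by
  -- Labels are sorted by depth, so those on levels at most `i` form an initial segment; `m'` is the
  -- first index beyond it.
  obtain ⟨m', hm', hlt⟩ : ∃ m' ≤ m, ∀ t : Fin m, t.val < m' ↔ (T.v t).length ≤ i := by
    by_cases h : ∀ t, (T.v t).length ≤ i
    · exact ⟨m, le_rfl, fun t => ⟨fun _ => h t, fun _ => t.2⟩⟩
    · push Not at h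
      obtain ⟨t₀, ht₀⟩ := h
      have hex : ∃ k, ∃ h : k < m, i < (T.v ⟨k, h⟩).length := ⟨t₀, t₀.2, ht₀⟩
      obtain ⟨hk, hk'⟩ := Nat.find_spec hex
      refine ⟨Nat.find hex, hk.le, fun t => ⟨fun h => ?_, fun h => ?_⟩⟩
      · have := Nat.find_min hex h
        push Not at this
        exact this t.2
      · by_contra! h'
        have := T.labels.sorted ⟨Nat.find hex, hk⟩ t h'
        omega
  have hr : ∀ w : List Bool, w.length ≤ i →
      (w ∈ Set.range (fun t : Fin m' => T.v ⟨t, t.2.trans_le hm'⟩) ↔ w ∈ Set.range T.v) := by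
    intro w hw
    constructor
    · rintro ⟨t, rfl⟩
      exact ⟨_, rfl⟩
    · rintro ⟨t, rfl⟩
      exact ⟨⟨t, (hlt t).2 hw⟩, rfl⟩
  let tree : CodeTree :=
    { nodes := T.tree.nodes.filter fun w => w.length ≤ i
      root_mem := by simp [T.tree.root_mem]
      parent_mem := by
        intro w c h
        simp only [Finset.mem_filter, List.length_append, List.length_singleton] at h ⊢
        exact ⟨T.tree.parent_mem w c h.1, by omega⟩ }
  have hmem : ∀ w, w ∈ tree.nodes ↔ w ∈ T.tree.nodes ∧ w.length ≤ i := by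
    intro w
    simp [tree]
  have hlen : ∀ t : Fin m', (T.v ⟨t, t.2.trans_le hm'⟩).length ≤ i :=
    fun t => (hlt ⟨t, t.2.trans_le hm'⟩).1 t.2
  refine ⟨m', ⟨tree, fun t => T.v ⟨t, t.2.trans_le hm'⟩, ?_, ?_, ?_, ?_⟩, hm', ?_, ?_, ?_⟩
  · rintro w ⟨hw, c, hc⟩ c'
    rw [hmem] at hw hc ⊢
    refine ⟨T.full w ⟨hw.1, c, hc.1⟩ c', ?_⟩
    simpa using hc.2
  · exact fun w hw => ((hmem w).1 hw).2
  · refine ⟨?_, fun t => ⟨?_, fun c => ?_⟩, fun t => T.labels.endsIn _, ?_⟩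
    · intro s t h
      have := T.labels.injective h
      simpa [Fin.ext_iff] using this
    · exact (hmem _).2 ⟨(T.labels.isLeaf _).1, hlen t⟩
    · intro h
      exact (T.labels.isLeaf _).2 c ((hmem _).1 h).1
    · intro s t hst
      exact T.labels.sorted _ _ hst
  · intro w hw hi
    rw [hr w hi.le]
    refine T.good_of_lt w ⟨((hmem _).1 hw.1).1, fun c hc => hw.2 c ((hmem _).2 ⟨hc, ?_⟩)⟩
      (by omega)
    simpa using hi
  · intro j hj
    simp only [CodeTree.badAt]
    congr 1
    ext w
    simp only [Finset.mem_filter, hmem]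
    constructor
    · rintro ⟨h1, h2, h3⟩
      exact ⟨⟨h1, by omega⟩, h2, by rwa [hr w (by omega)]⟩
    · rintro ⟨⟨h1, _⟩, h2, h3⟩
      exact ⟨h1, h2, by rwa [hr w (by omega)] at h3⟩
  · intro t h
    rfl
  · intro t h
    have h1 := T.length_v_le t
    have h2 := hlt t
    omega

open Classical in
-- Each bad node on level `i` receives both children, and exactly one of them is a 1-node; so
-- `T'.bad` is the number of places for new labels.
theorem exists_extend {m' : ℕ} (T' : PartialTree i m') {m : ℕ} (hm : m' ≤ m)
    (hk : m - m' ≤ T'.bad) : ∃ T : PartialTree (i + 1) m, T.Extends T' := by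
  obtain ⟨k, rfl⟩ := Nat.exists_eq_add_of_le hm
  simp only [Nat.add_sub_cancel_left] at hk
  set D := T'.tree.nodes.filter (fun w => w.length = i ∧ w ∉ Set.range T'.v) with hD
  have hDm : ∀ w, w ∈ D ↔ w ∈ T'.tree.nodes ∧ w.length = i ∧ w ∉ Set.range T'.v := by
    intro w
    simp [hD]
  obtain ⟨f, hf, hfi⟩ : ∃ f : Fin k → List Bool, (∀ x, f x ∈ D) ∧ Function.Injective f := by
    have hc : k ≤ D.card := hk
    exact ⟨fun x => (D.equivFin.symm (Fin.castLE hc x)).1, fun x => (D.equivFin.symm _).2,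
      fun x y h => by simpa [Subtype.ext_iff] using h⟩
  let tree : CodeTree :=
    { nodes := T'.tree.nodes ∪ (D ×ˢ (Finset.univ : Finset Bool)).image (fun x => x.1 ++ [x.2])
      root_mem := by simp [T'.tree.root_mem]
      parent_mem := by
        intro w c h
        simp only [Finset.mem_union, Finset.mem_image, Finset.mem_product, Finset.mem_univ,
          and_true, Prod.exists] at h ⊢
        rcases h with h | ⟨u, c', hu, h⟩
        · exact Or.inl (T'.tree.parent_mem w c h)
        · have := (List.append_inj' h rfl).1
          subst this
          exact Or.inl ((hDm u).1 hu).1 }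
  have hmem : ∀ w, w ∈ tree.nodes ↔ w ∈ T'.tree.nodes ∨ ∃ u ∈ D, ∃ c, u ++ [c] = w := by
    intro w
    simp [tree]
  have hmem' : ∀ w c, w ++ [c] ∈ tree.nodes ↔ w ++ [c] ∈ T'.tree.nodes ∨ w ∈ D := by
    intro w c
    rw [hmem]
    refine or_congr_right ⟨?_, fun h => ⟨w, h, c, rfl⟩⟩
    rintro ⟨u, hu, c', h⟩
    exact (List.append_inj' h rfl).1 ▸ hu
  have hle : ∀ w ∈ tree.nodes, w.length ≤ i → w ∈ T'.tree.nodes := by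
    intro w hw hi
    rcases (hmem w).1 hw with h | ⟨u, hu, c, rfl⟩
    · exact h
    · have := ((hDm u).1 hu).2.1
      simp at hi
      omega
  have hlen : ∀ w ∈ tree.nodes, w.length ≤ i + 1 := by
    intro w hw
    rcases (hmem w).1 hw with h | ⟨u, hu, c, rfl⟩
    · have := T'.length_le w h
      omega
    · simp [((hDm u).1 hu).2.1]
  -- The new labels lie on level `i + 1`, below all old ones, so appending them keeps the order by
  -- depth.
  set v : Fin (m' + k) → List Bool := Fin.append T'.v (fun x => f x ++ [true]) with hv
  have hvl : ∀ t, v (Fin.castAdd k t) = T'.v t := by simp [hv]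
  have hvr : ∀ x, v (Fin.natAdd m' x) = f x ++ [true] := by simp [hv]
  have hll : ∀ t, (v (Fin.castAdd k t)).length ≤ i := fun t => by
    rw [hvl]
    exact T'.length_v_le t
  have hlr : ∀ x, (v (Fin.natAdd m' x)).length = i + 1 := fun x => by
    simp [hvr, ((hDm _).1 (hf x)).2.1]
  have hr : ∀ w : List Bool, w.length ≤ i → (w ∈ Set.range v ↔ w ∈ Set.range T'.v) := by
    intro w hw
    constructor
    · rintro ⟨t, rfl⟩
      induction t using Fin.addCases with
      | left t => exact ⟨t, (hvl t).symm⟩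
      | right x =>
        rw [hlr] at hw
        omega
    · rintro ⟨t, rfl⟩
      exact ⟨_, hvl t⟩
  refine ⟨⟨tree, v, ?_, hlen, ⟨?_, ?_, ?_, ?_⟩, ?_⟩, hm, ?_, ?_, ?_⟩
  · rintro w ⟨hw, c, hc⟩ c'
    rw [hmem'] at hc ⊢
    rcases hc with hc | hc
    · exact Or.inl (T'.full w ⟨T'.tree.parent_mem _ _ hc, c, hc⟩ c')
    · exact Or.inr hc
  · intro s t h
    induction s using Fin.addCases with
    | left s =>
      induction t using Fin.addCases with
      | left t =>
        rw [hvl, hvl] at h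
        rw [T'.labels.injective h]
      | right y =>
        have h1 := hll s
        have h2 := hlr y
        rw [h] at h1
        omega
    | right x =>
      induction t using Fin.addCases with
      | left t =>
        have h1 := hll t
        have h2 := hlr x
        rw [h] at h2
        omega
      | right y =>
        rw [hvr, hvr] at h
        rw [hfi (List.append_inj' h rfl).1]
  · intro t
    induction t using Fin.addCases with
    | left t =>
      rw [hvl]
      refine ⟨(hmem _).2 (Or.inl (T'.labels.isLeaf t).1), fun c => ?_⟩
      rw [hmem']
      rintro (h | h)
      · exact (T'.labels.isLeaf t).2 c h
      · exact ((hDm _).1 h).2.2 ⟨t, rfl⟩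
    | right x =>
      refine ⟨by rw [hvr, hmem']; exact Or.inr (hf x), fun c hc => ?_⟩
      have := hlen _ hc
      simp [hlr] at this
  · intro t
    induction t using Fin.addCases with
    | left t =>
      rw [hvl]
      exact T'.labels.endsIn t
    | right x =>
      rw [hvr]
      exact ⟨_, rfl⟩
  · intro s t hst
    induction t using Fin.addCases with
    | left t =>
      induction s using Fin.addCases with
      | left s =>
        rw [hvl, hvl]
        exact T'.labels.sorted s t hst
      | right x =>
        have h2 := t.2
        simp [Fin.le_def] at hst
        omega
    | right y =>
      rw [hlr]
      induction s using Fin.addCases with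
      | left s => exact (hll s).trans (Nat.le_succ i)
      | right x => rw [hlr]
  · intro w hw hi
    rw [hr w (by omega)]
    have hw' := hle w hw.1 (by omega)
    by_contra hn
    rcases (Nat.lt_succ_iff.1 hi).lt_or_eq with h | h
    · obtain ⟨c, hc⟩ := (T'.isInternal hw' h hn).2
      exact hw.2 c ((hmem' w c).2 (Or.inl hc))
    · exact hw.2 true ((hmem' w true).2 (Or.inr ((hDm w).2 ⟨hw', h, hn⟩)))
  · intro j hj
    simp only [CodeTree.badAt]
    congr 1
    ext w
    simp only [Finset.mem_filter]
    constructor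
    · rintro ⟨h1, h2, h3⟩
      exact ⟨hle w h1 (by omega), h2, by rwa [hr w (by omega)] at h3⟩
    · rintro ⟨h1, h2, h3⟩
      exact ⟨(hmem w).2 (Or.inl h1), h2, by rwa [hr w (by omega)]⟩
  · intro t h
    exact congrArg List.length (hvl ⟨t, h⟩)
  · intro t h
    have : t = Fin.natAdd m' ⟨t - m', by omega⟩ := by
      ext
      simp
      omega
    rw [this]
    exact hlr _

namespace Extends

variable {m' : ℕ} {T : PartialTree (i + 1) m} {T' : PartialTree i m'}

theorem badAt_self (h : T.Extends T') : T.tree.badAt T.v i = T'.bad := h.badAt i le_rfl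

theorem length_eq_iff (h : T.Extends T') (t : Fin m) :
    (T.v t).length = i + 1 ↔ m' ≤ t.val := by
  refine ⟨fun h' => ?_, h.length' t⟩
  by_contra! hlt
  have := T'.length_v_le ⟨t, hlt⟩
  rw [← h.length] at this
  omega

theorem bad_add (h : T.Extends T') : m + T.bad = m' + 2 * T'.bad := by
  have h1 := T.badAt_succ (Nat.lt_succ_self i)
  have h2 : (Finset.univ.filter fun t => (T.v t).length = i + 1).card = m - m' := by
    simp only [h.length_eq_iff]
    have h3 : (Finset.univ.filter fun t : Fin m => ¬ m' ≤ t.val).card = m' := by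
      simp only [not_le, Fin.card_filter_val_lt]
      exact min_eq_right h.le
    have h4 := Finset.card_filter_add_card_filter_not (s := (Finset.univ : Finset (Fin m)))
      (fun t => m' ≤ t.val)
    simp only [Finset.card_univ, Fintype.card_fin] at h4
    omega
  have h5 := h.le
  rw [h2, h.badAt_self] at h1
  change T.bad + _ = _ at h1
  omega

theorem le_bad (h : T.Extends T') : T'.bad ≤ T.bad := by
  rw [← h.badAt_self]
  exact T.badAt_le_succ (Nat.lt_succ_self i)

/-- Labels up to `m'` keep their depth. Every later weight was charged `i` and is now charged `i +
1`, whether it has just been labelled or is still waiting. -/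
theorem partialCost (h : T.Extends T') {n : ℕ} (p : Fin n → ℝ) :
    T.partialCost p = T'.partialCost p + W p m' := by
  unfold PartialTree.partialCost W
  rw [← Finset.sum_add_distrib]
  refine Finset.sum_congr rfl fun t _ => ?_
  have hle := h.le
  by_cases h1 : t.val < m'
  · have h2 : t.val < m := h1.trans_le hle
    rw [dif_pos h1, dif_pos h2, h.length ⟨t, h2⟩ h1]
    simp [h1]
  · by_cases h2 : t.val < m
    · rw [dif_neg h1, dif_pos h2, h.length' ⟨t, h2⟩ (by simpa using h1), if_pos (by omega)]
      push_cast
      ring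
    · rw [dif_neg h1, dif_neg h2, if_pos (by omega)]
      push_cast
      ring

end Extends

theorem bad_pos (T : PartialTree i m) : 1 ≤ T.bad := T.one_le_badAt le_rfl

theorem eq_zero (T : PartialTree 0 m) : m = 0 ∧ T.bad = 1 := by
  refine ⟨?_, CodeTree.badAt_zero T.labels⟩
  by_contra hm
  have h := T.length_v_le ⟨0, Nat.pos_of_ne_zero hm⟩
  have h' := T.labels.endsIn ⟨0, Nat.pos_of_ne_zero hm⟩
  rw [List.length_eq_zero_iff.1 (Nat.le_zero.1 h)] at h'
  exact not_endsIn_nil h'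

/-- One more level turns `m' + b'` into `m' + 2b'` with `b' ≥ 1`, so `m + b` increases strictly with
the level. -/
theorem level_lt (T : PartialTree i m) : i < m + T.bad := by
  induction i generalizing m with
  | zero =>
    have := T.bad_pos
    omega
  | succ i ih =>
    obtain ⟨m', T', h⟩ := T.exists_truncate
    have h1 := ih T'
    have h2 := h.bad_add
    have h3 := T'.bad_pos
    omega

/-- The tree that consists of its root. -/
def root : PartialTree 0 0 where
  tree := ⟨{[]}, by simp, by simp⟩
  v := Fin.elim0
  full := by
    rintro w ⟨_, c, hc⟩
    simp at hc
  length_le := by simp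
  labels := ⟨fun t => t.elim0, fun t => t.elim0, fun t => t.elim0, fun t => t.elim0⟩
  good_of_lt := by
    intro w _ h
    simp at h

theorem partialCost_nonneg (T : PartialTree i m) {n : ℕ} {p : Fin n → ℝ} (hp : ∀ t, 0 ≤ p t) :
    0 ≤ T.partialCost p := by
  refine Finset.sum_nonneg fun t _ => mul_nonneg (hp t) ?_
  split_ifs <;> positivity

theorem partialCost_eq_cost {n : ℕ} (T : PartialTree i n) (p : Fin n → ℝ) :
    T.partialCost p = cost p T.v := by
  simp [partialCost, cost]

end PartialTree

/-! ### The dynamic program -/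

section OPT

variable {n : ℕ} {p : Fin n → ℝ}

theorem OPT_le {i m : ℕ} (T : PartialTree i m) : OPT p m T.bad ≤ T.partialCost p :=
  iInf_le_of_le i (iInf_le_of_le T (iInf_le_of_le rfl le_rfl))

/-- The infimum is over infinitely many trees, but by `level_lt` all depths are at most `m + b`, so
only finitely many partial costs occur. -/
theorem exists_eq_OPT {m b : ℕ} (h : OPT p m b ≠ ⊤) :
    ∃ (i : ℕ) (T : PartialTree i m), T.bad = b ∧ OPT p m b = (T.partialCost p : EReal) := by
  let S : Set ℝ := {x | ∃ (i : ℕ) (T : PartialTree i m), T.bad = b ∧ T.partialCost p = x}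
  have hfin : S.Finite := by
    refine (Set.finite_range fun L : Fin n → Fin (m + b + 1) =>
      ∑ t, p t * ((L t).val : ℝ)).subset ?_
    rintro x ⟨i, T, rfl, rfl⟩
    have hi := T.level_lt
    refine ⟨fun t => if h : t.val < m then ⟨(T.v ⟨t, h⟩).length, ?_⟩ else ⟨i, by omega⟩, ?_⟩
    · have := T.length_v_le ⟨t, h⟩
      omega
    · refine Finset.sum_congr rfl fun t _ => ?_
      by_cases h : t.val < m <;> simp [h]
  have hne : S.Nonempty := by
    by_contra hS
    apply h
    simp only [OPT, iInf_eq_top]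
    intro i T hT
    exact absurd ⟨_, i, T, hT, rfl⟩ hS
  obtain ⟨x, ⟨i, T, hT, rfl⟩, hx⟩ := Set.exists_min_image S id hfin hne
  refine ⟨i, T, hT, le_antisymm (hT ▸ OPT_le T) ?_⟩
  refine le_iInf fun j => le_iInf fun T' => le_iInf fun hT' => ?_
  exact EReal.coe_le_coe_iff.2 (hx _ ⟨j, T', hT', rfl⟩)

theorem OPT_zero_one (hp : ∀ t, 0 ≤ p t) : OPT p 0 1 = 0 := by
  refine le_antisymm ?_ ?_
  · have h := OPT_le (p := p) PartialTree.root
    rw [PartialTree.root.eq_zero.2] at h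
    refine h.trans ?_
    simp [PartialTree.partialCost]
  · refine le_iInf fun j => le_iInf fun T' => le_iInf fun hT' => ?_
    exact EReal.coe_nonneg.2 (T'.partialCost_nonneg hp)

theorem OPT_bad_zero (m : ℕ) : OPT p m 0 = ⊤ := by
  simp only [OPT, iInf_eq_top]
  intro i T hT
  have := T.bad_pos
  omega

/-- The expansion relation without bounds on the signatures. -/
def Expansion (q' q : ℕ × ℕ) : Prop :=
  q'.1 ≤ q.1 ∧ q.1 + q.2 = q'.1 + 2 * q'.2 ∧ 1 ≤ q'.2 ∧ q'.2 ≤ q.2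

/-- Neither component decreases in an expansion, so validity passes to predecessors, and `b ≤ 2b'`
follows from `m' ≤ m`. The theory can thus ignore the bounds on signatures. -/
theorem expands_iff {q' q : ℕ × ℕ} (hq : Valid n q) : Expands n q' q ↔ Expansion q' q := by
  unfold Expands Expansion Valid at *
  omega

theorem PartialTree.Extends.expansion {i m m' : ℕ} {T : PartialTree (i + 1) m}
    {T' : PartialTree i m'} (h : T.Extends T') : Expansion (m', T'.bad) (m, T.bad) :=
  ⟨h.le, h.bad_add, T'.bad_pos, h.le_bad⟩

theorem PartialTree.exists_extend_of_expansion {i m' m b : ℕ} (T' : PartialTree i m')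
    (h : Expansion (m', T'.bad) (m, b)) :
    ∃ T : PartialTree (i + 1) m, T.Extends T' ∧ T.bad = b := by
  obtain ⟨h1, h2, h3, h4⟩ := h
  simp only at h1 h2 h3 h4
  obtain ⟨T, hT⟩ := T'.exists_extend h1 (by omega)
  have := hT.bad_add
  exact ⟨T, hT, by omega⟩

theorem OPT_le_of_expansion {q : ℕ × ℕ} {m b : ℕ} (h : Expansion q (m, b)) :
    OPT p m b ≤ OPT p q.1 q.2 + (W p q.1 : EReal) := by
  obtain ⟨m', b'⟩ := q
  by_cases htop : OPT p m' b' = ⊤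
  · simp [htop]
  · obtain ⟨i, T', rfl, hT'⟩ := exists_eq_OPT htop
    obtain ⟨T, hT, rfl⟩ := T'.exists_extend_of_expansion h
    refine (OPT_le T).trans ?_
    rw [hT.partialCost p, hT', EReal.coe_add]

/-- Growing an optimal tree for a predecessor gives one inequality, truncating an arbitrary tree the
other. Only level 0 cannot be truncated, and its sole signature is `(0, 1)`. -/
theorem OPT_eq_iInf {m b : ℕ} (h : (m, b) ≠ (0, 1)) :
    OPT p m b = ⨅ (q : ℕ × ℕ) (_ : Expansion q (m, b)),
      (OPT p q.1 q.2 + (W p q.1 : EReal)) := by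
  refine le_antisymm (le_iInf fun q => le_iInf fun hq => OPT_le_of_expansion hq) ?_
  refine le_iInf fun i => le_iInf fun T => le_iInf fun hT => ?_
  subst hT
  cases i with
  | zero => exact absurd (Prod.ext T.eq_zero.1 T.eq_zero.2) h
  | succ i =>
    obtain ⟨m', T', hT⟩ := T.exists_truncate
    refine iInf_le_of_le (m', T'.bad) (iInf_le_of_le hT.expansion ?_)
    rw [hT.partialCost p, EReal.coe_add]
    exact add_le_add_left (OPT_le T') _

/-- The predecessor is determined by `b'`, as `m' = d - 2b'`. The condition `2b' ≤ d` keeps this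
subtraction from being truncated, and `1 ≤ b'` follows from `b ≤ 2b'`. -/
theorem expansion_iff_exists {d m b : ℕ} (hb : 0 < b) (hd : m + b = d) (q : ℕ × ℕ) :
    Expansion q (m, b) ↔
      ∃ b', (b ≤ 2 * b' ∧ b' ≤ b ∧ 2 * b' ≤ d) ∧ q = (d - 2 * b', b') := by
  obtain ⟨m', b'⟩ := q
  simp only [Expansion, Prod.mk.injEq]
  constructor
  · rintro ⟨h1, h2, h3, h4⟩
    exact ⟨b', by omega, by omega, rfl⟩
  · rintro ⟨x, hx, h1, rfl⟩
    omega

theorem OPT_eq_iInf_gamma {d m b : ℕ} (hd : 2 ≤ d) (hb : 0 < b) (h : m + b = d) :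
    OPT p m b = ⨅ (b' : ℕ) (_ : b ≤ 2 * b' ∧ b' ≤ b ∧ 2 * b' ≤ d), gamma p d b' := by
  rw [OPT_eq_iInf (by simp only [ne_eq, Prod.mk.injEq]; omega)]
  simp only [expansion_iff_exists hb h]
  refine le_antisymm ?_ ?_
  · refine le_iInf fun b' => le_iInf fun hb' => ?_
    exact iInf_le_of_le (d - 2 * b', b') (iInf_le_of_le ⟨b', hb', rfl⟩ le_rfl)
  · refine le_iInf fun q => le_iInf ?_
    rintro ⟨b', hb', rfl⟩
    exact iInf_le_of_le b' (iInf_le_of_le hb' le_rfl)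

theorem exists_eq_gamma {m b : ℕ} (hd : 2 ≤ m + b) (h : OPT p m b ≠ ⊤) :
    ∃ b', (b ≤ 2 * b' ∧ b' ≤ b ∧ 2 * b' ≤ m + b) ∧ gamma p (m + b) b' ≤ OPT p m b := by
  obtain ⟨i, T, rfl, hT⟩ := exists_eq_OPT h
  have hpos := T.bad_pos
  cases i with
  | zero =>
    have := T.eq_zero
    omega
  | succ i =>
    obtain ⟨m', T', hE⟩ := T.exists_truncate
    obtain ⟨b', hb', hq⟩ := (expansion_iff_exists hpos rfl _).1 hE.expansion
    simp only [Prod.mk.injEq] at hq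
    refine ⟨b', hb', ?_⟩
    rw [hT, hE.partialCost p, EReal.coe_add, gamma, ← hq.1, ← hq.2]
    exact add_le_add_left (OPT_le _) _

/-- A sequence of expansions along which the minimum is attained is the sequence of signatures
of the truncations of a minimum-cost tree. -/
theorem exists_tree_of_chain (hp : ∀ t, 0 ≤ p t) {ms bs : ℕ → ℕ} (hm : ms 0 = 0)
    (hb : bs 0 = 1) {l m b : ℕ} (hml : ms l = m) (hbl : bs l = b)
    (h : ∀ i < l, Expansion (ms i, bs i) (ms (i + 1), bs (i + 1)) ∧
      OPT p (ms i) (bs i) + (W p (ms i) : EReal) ≤ OPT p (ms (i + 1)) (bs (i + 1))) :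
    ∃ T : PartialTree l m, (T.partialCost p : EReal) = OPT p m b ∧
      ∀ i ≤ l, ms i = (Finset.univ.filter (fun t => (T.v t).length ≤ i)).card ∧
        bs i = T.tree.badAt T.v i := by
  subst hml hbl
  induction l with
  | zero =>
    rw [hm, hb]
    refine ⟨PartialTree.root, ?_, ?_⟩
    · rw [OPT_zero_one hp]
      simp [PartialTree.partialCost]
    · intro i hi
      obtain rfl : i = 0 := by omega
      exact ⟨by simp [hm], by rw [hb, CodeTree.badAt_zero PartialTree.root.labels]⟩
  | succ l ih =>
    obtain ⟨T', hT', hi'⟩ := ih fun i hi => h i (by omega)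
    obtain ⟨hE, hle⟩ := h l (by omega)
    have hbad : T'.bad = bs l := (hi' l le_rfl).2.symm
    rw [← hbad] at hE
    obtain ⟨T, hT, hTb⟩ := T'.exists_extend_of_expansion hE
    refine ⟨T, le_antisymm ?_ (hTb ▸ OPT_le T), ?_⟩
    · rw [hT.partialCost p, EReal.coe_add, hT']
      exact hle
    · intro i hi
      rcases Nat.lt_or_eq_of_le hi with hi | rfl
      · have hil : i ≤ l := by omega
        refine ⟨?_, by rw [hT.badAt i hil]; exact (hi' i hil).2⟩
        rw [(hi' i hil).1]
        refine Finset.card_bij (fun t _ => Fin.castLE hT.le t) ?_ ?_ ?_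
        · intro t ht
          simp only [Finset.mem_filter, Finset.mem_univ, true_and] at ht ⊢
          rw [hT.length _ (by simp)]
          exact ht
        · intro s _ t _ h
          simpa using h
        · intro t ht
          simp only [Finset.mem_filter, Finset.mem_univ, true_and] at ht ⊢
          have hlt : t.val < ms l := by
            by_contra! hge
            have := hT.length' t hge
            omega
          refine ⟨⟨t, hlt⟩, ?_, rfl⟩
          rw [← hT.length t hlt]
          exact ht
      · refine ⟨?_, hTb.symm⟩
        rw [Finset.filter_true_of_mem fun t _ => T.length_v_le t]
        simp

end OPT

/-! ### Structure of optimal trees -/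

open Classical in
/-- The tree of a sorted code: the words of length at most `l` that properly extend no code
word. -/
theorem exists_partialTree {n l : ℕ} {v : Fin n → List Bool} (hv : IsOneEndedCode v)
    (hs : ∀ s t, s ≤ t → (v s).length ≤ (v t).length) (hl : ∀ t, (v t).length ≤ l) :
    ∃ T : PartialTree l n, T.v = v := by
  have hfin : {w : List Bool | w.length ≤ l}.Finite := List.finite_length_le Bool l
  have hpre : ∀ t w c, v t <+: w ++ [c] → v t = w ++ [c] ∨ v t <+: w := by
    intro t w c h
    exact List.prefix_concat_iff.1 h
  have hne : ∀ (w : List Bool) c, w ≠ w ++ [c] := by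
    intro w c h
    simpa using congrArg List.length h
  have hnp : ∀ t w c, v t <+: w → v t ≠ w ++ [c] := by
    intro t w c h h'
    have := h.length_le
    simp [h'] at this
  let tree : CodeTree :=
    { nodes := hfin.toFinset.filter fun w => ∀ t, v t <+: w → v t = w
      root_mem := by simp
      parent_mem := by
        intro w c h
        simp only [Finset.mem_filter, Set.Finite.mem_toFinset, Set.mem_ofPred_eq] at h ⊢
        refine ⟨by have := h.1; simp at this; omega, fun t ht => ?_⟩
        exact absurd (h.2 t (ht.trans (List.prefix_append _ _))) (hnp t w c ht) }
  have hmem : ∀ w, w ∈ tree.nodes ↔ w.length ≤ l ∧ ∀ t, v t <+: w → v t = w := by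
    intro w
    simp [tree]
  refine ⟨⟨tree, v, ?_, ?_, ⟨?_, ?_, hv.1, hs⟩, ?_⟩, rfl⟩
  · rintro w ⟨hw, c, hc⟩ c'
    rw [hmem] at hc ⊢
    refine ⟨by simpa using hc.1, fun t ht => ?_⟩
    rcases hpre t w c' ht with h | h
    · exact h
    · exact absurd (hc.2 t (h.trans (List.prefix_append _ _))) (hnp t w c h)
  · exact fun w hw => ((hmem w).1 hw).1
  · intro s t h
    by_contra hst
    exact hv.2 s t hst (h ▸ List.prefix_rfl)
  · intro t
    refine ⟨(hmem _).2 ⟨hl t, fun s hs => ?_⟩, fun c hc => ?_⟩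
    · by_contra hst
      exact hv.2 s t (fun h => hst (h ▸ rfl)) hs
    · exact hne _ c (((hmem _).1 hc).2 t (List.prefix_append _ _))
  -- A leaf `w` above level `l` lacks its 0-child, which is short enough; so some code word is a
  -- prefix of `w0`. It differs from `w0`, hence is a prefix of `w`, and equals `w` because `w` is a
  -- node.
  · intro w hw hi
    have := hw.2 false
    rw [hmem] at this
    push Not at this
    obtain ⟨t, ht, ht'⟩ := this (by simpa using hi)
    rcases hpre t w false ht with h | h
    · exact absurd h ht'
    · exact ⟨t, ((hmem w).1 hw.1).2 t h⟩

theorem IsOneEndedCode.comp {n : ℕ} {v : Fin n → List Bool} (hv : IsOneEndedCode v)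
    (σ : Equiv.Perm (Fin n)) : IsOneEndedCode (v ∘ σ) :=
  ⟨fun _ => hv.1 _, fun _ _ hst => hv.2 _ _ fun h => hst (σ.injective h)⟩

/-- This is the rearrangement inequality: nonincreasing weights paired with nondecreasing lengths
give the least sum. -/
theorem cost_comp_sort_le {n : ℕ} {p : Fin n → ℝ} (hp : Antitone p)
    (v : Fin n → List Bool) :
    cost p (v ∘ Tuple.sort fun t => (v t).length) ≤ cost p v := by
  set σ := Tuple.sort fun t => (v t).length with hσ
  have hmono : Monotone ((fun t => (v t).length) ∘ σ) := Tuple.monotone_sort _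
  have hanti : Antivary p (fun t => (((v (σ t)).length : ℕ) : ℝ)) := by
    intro s t hst
    refine hp (le_of_lt ?_)
    by_contra! hts
    have := hmono hts
    simp only [Function.comp_apply] at this
    have h2 : ((v (σ s)).length) < ((v (σ t)).length) := Nat.cast_lt (α := ℝ).1 hst
    omega
  have := hanti.sum_mul_le_sum_mul_comp_perm (σ := σ⁻¹)
  simpa [cost] using this

/-- A code of minimum total length among the codes whose cost does not exceed that of `w`. -/
theorem exists_minimal_code {n : ℕ} {p : Fin n → ℝ} (hp : Antitone p)
    {w : Fin n → List Bool} (hw : IsOneEndedCode w) :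
    ∃ v : Fin n → List Bool, IsOneEndedCode v ∧ cost p v ≤ cost p w ∧
      (∀ s t, s ≤ t → (v s).length ≤ (v t).length) ∧
      ∀ u, IsOneEndedCode u → cost p u ≤ cost p v →
        ∑ t, (v t).length ≤ ∑ t, (u t).length := by
  let f : (Fin n → List Bool) → ℕ := fun v => ∑ t, (v t).length
  obtain ⟨v, ⟨hv, hc⟩, hmin⟩ := (measure f).wf.has_min
    {v | IsOneEndedCode v ∧ cost p v ≤ cost p w} ⟨w, hw, le_rfl⟩
  set σ := Tuple.sort fun t => (v t).length with hσ
  have hle := cost_comp_sort_le hp v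
  refine ⟨v ∘ σ, hv.comp σ, hle.trans hc, fun s t hst => ?_, fun u hu hu' => ?_⟩
  · exact Tuple.monotone_sort (fun t => (v t).length) hst
  · have h1 : ∑ t, ((v ∘ σ) t).length = f v := Equiv.sum_comp σ fun t => (v t).length
    rw [h1]
    exact not_lt.1 (hmin u ⟨hu, hu'.trans (hle.trans hc)⟩)

theorem height_eq {i m : ℕ} (T : PartialTree i m) {t : Fin m} (ht : (T.v t).length = i) :
    T.tree.height = i := by
  refine le_antisymm (Finset.sup_le T.length_le) (ht.ge.trans ?_)
  exact Finset.le_sup (f := List.length) (T.labels.isLeaf t).1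

open Classical in
-- Such a node `u` could be a code word in place of `u1`, or of the deepest word `v t₁` if `u1` is
-- not used. The total length falls and the cost does not rise. Weights may be zero, so the cost
-- alone need not drop; this is why minimality refers to total length.
theorem not_isInternal_of_minimal {n l : ℕ} {p : Fin n → ℝ} (hp : ∀ t, 0 ≤ p t)
    (T : PartialTree l n)
    (hmin : ∀ u, IsOneEndedCode u → cost p u ≤ cost p T.v →
      ∑ t, (T.v t).length ≤ ∑ t, (u t).length)
    {t₁ : Fin n} (ht₁ : (T.v t₁).length = l) {u : List Bool} (hu : T.tree.IsInternal u)
    (hu1 : EndsIn true u) (hul : u.length + 1 = l) : False := by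
  set v := T.v with hv
  have hcode := T.labels.isOneEndedCode
  rw [← hv] at hcode
  have hnp : ∀ t, ¬ v t <+: u := by
    intro t h
    obtain ⟨x, hx⟩ := h
    cases x with
    | nil => exact T.labels.not_mem_range_of_isInternal hu ⟨t, by simpa using hx⟩
    | cons c x =>
      refine (T.labels.isLeaf t).2 c (CodeTree.mem_of_prefix ⟨x, ?_⟩ hu.1)
      simpa using hx
  obtain ⟨t₀, ht₀, hu₀⟩ : ∃ t₀, (v t₀).length = l ∧ ∀ t, v t = u ++ [true] → t = t₀ := by
    by_cases h : ∃ t, v t = u ++ [true]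
    · obtain ⟨t, ht⟩ := h
      refine ⟨t, by simp [ht, hul], fun s hs => T.labels.injective (hs.trans ht.symm)⟩
    · exact ⟨t₁, ht₁, fun t ht => absurd ⟨t, ht⟩ h⟩
  -- A code word below `u` has length at most `l = |u| + 1` and ends in 1, so it can only be `u1`,
  -- the word that is being replaced.
  have hnu : ∀ t, t ≠ t₀ → ¬ u <+: v t := by
    intro t ht h
    rcases (List.IsPrefix.length_le h).lt_or_eq with hlt | heq
    · obtain ⟨x, hx⟩ := h
      have hlen : (v t).length ≤ l := T.length_v_le t
      have hx1 : x.length = 1 := by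
        have := congrArg List.length hx
        simp only [List.length_append] at this
        omega
      obtain ⟨c, rfl⟩ := List.length_eq_one_iff.1 hx1
      have hc := hcode.1 t
      rw [← hx, endsIn_concat] at hc
      subst hc
      exact ht (hu₀ t hx.symm)
    · exact hnp t (h.eq_of_length heq ▸ List.prefix_rfl)
  have hcode' : IsOneEndedCode (Function.update v t₀ u) := by
    constructor
    · intro t
      by_cases h : t = t₀
      · simpa [h] using hu1
      · simpa [h] using hcode.1 t
    · intro s t hst
      by_cases hs : s = t₀
      · subst hs
        have : t ≠ s := fun h => hst h.symm
        simpa [this] using hnu t this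
      · by_cases ht : t = t₀
        · subst ht
          simpa [hs] using hnp s
        · simpa [hs, ht] using hcode.2 s t hst
  have hlen : ∀ t, (Function.update v t₀ u t).length ≤ (v t).length := by
    intro t
    by_cases h : t = t₀
    · subst h
      simp
      omega
    · simp [h]
  have h1 := hmin _ hcode' <| Finset.sum_le_sum fun t _ =>
    mul_le_mul_of_nonneg_left (by exact_mod_cast hlen t) (hp t)
  have h2 : ∑ t, (Function.update v t₀ u t).length < ∑ t, (v t).length := by
    refine Finset.sum_lt_sum (fun t _ => hlen t) ⟨t₀, Finset.mem_univ _, ?_⟩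
    simp
    omega
  omega

open Classical in
theorem card_filter_length_lt {i n : ℕ} (T : PartialTree i n) {t₁ : Fin n}
    (ht₁ : (T.v t₁).length = i) :
    ((Finset.univ.filter fun t => (T.v t).length < i).image T.v).card ≤ n - 1 := by
  refine Finset.card_image_le.trans ?_
  have : (Finset.univ.filter fun t => (T.v t).length < i) ⊆ Finset.univ.erase t₁ := by
    intro t ht
    simp only [Finset.mem_filter, Finset.mem_univ, true_and] at ht
    simp only [Finset.mem_erase, Finset.mem_univ, and_true]
    rintro rfl
    omega
  simpa using Finset.card_le_card this

open Classical in
theorem structural_of_oneInternal {l n : ℕ} (T : PartialTree l n) {t₁ : Fin n}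
    (ht₁ : (T.v t₁).length = l)
    (hb : ∀ u, T.tree.IsInternal u → EndsIn true u → u.length + 1 ≠ l) :
    T.tree.Structural n := by
  have hh : T.tree.height = l := height_eq T ht₁
  have hint : ∀ u, T.tree.IsInternal u → u.length + 1 ≤ l := by
    rintro u ⟨_, c, hc⟩
    simpa using T.length_le _ hc
  refine ⟨T.full, ?_, ?_, ?_, ?_⟩
  · intro w hw h1
    rw [hh]
    exact lt_of_le_of_ne (hint w hw) (hb w hw h1)
  · intro w hw h0
    rw [hh]
    by_contra hne
    obtain ⟨t, rfl⟩ := T.good_of_lt w hw (lt_of_le_of_ne (T.length_le w hw.1) hne)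
    obtain ⟨u, hu⟩ := T.labels.endsIn t
    rw [hu, endsIn_concat] at h0
    simp at h0
  · refine (Finset.card_le_card ?_).trans (card_filter_length_lt T ht₁)
    intro w hw
    simp only [Finset.mem_filter, Finset.mem_image, Finset.mem_univ, true_and, hh] at hw ⊢
    obtain ⟨t, rfl⟩ := T.good_of_lt w hw.2.1 hw.2.2.2
    exact ⟨t, hw.2.2.2, rfl⟩
  · refine le_trans ?_ (card_filter_length_lt T ht₁)
    -- A 0-internal on level `l - 1` is sent to its 1-sibling, which exists by fullness, is not
    -- internal by `hb`, and hence is a label of length less than `l`.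
    refine Finset.card_le_card_of_injOn (fun w => w.dropLast ++ [true]) ?_ ?_
    · intro w hw
      simp only [Finset.coe_filter, Set.mem_ofPred_eq, hh] at hw
      obtain ⟨hw1, hw2, ⟨u, rfl⟩, hl⟩ := hw
      have hl' : (u ++ [true]).length + 1 = l := by simpa using hl
      have hmem : u ++ [true] ∈ T.tree.nodes :=
        T.full u ⟨T.tree.parent_mem _ _ hw1, false, hw1⟩ true
      have hr : u ++ [true] ∈ Set.range T.v := by
        by_contra hr
        exact hb _ (T.isInternal hmem (by omega) hr) ⟨u, rfl⟩ hl'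
      obtain ⟨t, ht⟩ := hr
      simp only [List.dropLast_concat, Finset.coe_image, Finset.coe_filter, Finset.mem_univ,
        true_and, Set.mem_image, Set.mem_ofPred_eq]
      exact ⟨t, by rw [ht]; omega, ht⟩
    · intro w hw w' hw' h
      simp only [Finset.coe_filter, Set.mem_ofPred_eq] at hw hw'
      obtain ⟨_, _, ⟨u, rfl⟩, _⟩ := hw
      obtain ⟨_, _, ⟨u', rfl⟩, _⟩ := hw'
      simpa using h

theorem exists_structural {n : ℕ} (hn : 1 ≤ n) {p : Fin n → ℝ} (hp : ∀ t, 0 ≤ p t)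
    (hpa : Antitone p) {w : Fin n → List Bool} (hw : IsOneEndedCode w) :
    ∃ (l : ℕ) (T : PartialTree l n), cost p T.v ≤ cost p w ∧ T.tree.Structural n ∧
      ∃ t, (T.v t).length = l := by
  obtain ⟨v, hv, hc, hs, hmin⟩ := exists_minimal_code hpa hw
  have hlast : ∀ t : Fin n, t ≤ ⟨n - 1, by omega⟩ := fun t => by
    rw [Fin.le_def]
    have := t.2
    simp only
    omega
  obtain ⟨l, hl⟩ : ∃ l, (v ⟨n - 1, by omega⟩).length = l := ⟨_, rfl⟩
  obtain ⟨T, rfl⟩ := exists_partialTree (l := l) hv hs fun t => (hs t _ (hlast t)).trans hl.le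
  exact ⟨l, T, hc, structural_of_oneInternal T hl fun u hu hu1 hul =>
    not_isInternal_of_minimal hp T hmin hl hu hu1 hul, _, hl⟩

/-- The assertion that no unlabelled 1-leaf is above a labelled one. -/
def ShallowFirst (T : CodeTree) {n : ℕ} (v : Fin n → List Bool) : Prop :=
  ∀ w, T.IsLeaf w → EndsIn true w → w ∉ Set.range v → ∀ t, (v t).length ≤ w.length

theorem PartialTree.shallowFirst {l n : ℕ} (T : PartialTree l n) :
    ShallowFirst T.tree T.v := by
  intro w hw _ hr t
  refine (T.length_v_le t).trans ?_
  by_contra! h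
  exact hr (T.good_of_lt w hw h)

/-! ### Bad nodes in trees that satisfy (a)-(e) -/

namespace CodeTree.Structural

variable {T : CodeTree} {n : ℕ} {v : Fin n → List Bool}

theorem length_le_height (w : List Bool) (hw : w ∈ T.nodes) : w.length ≤ T.height :=
  Finset.le_sup (f := List.length) hw

open Classical in
-- Otherwise all `n` labels would be 1-leaves above the last level, against (d).
theorem exists_length_eq (h : T.Structural n) (hn : 1 ≤ n) (hv : T.Labels v) :
    ∃ t, (v t).length = T.height := by
  by_contra! hne
  have h1 : (Finset.univ.image v) ⊆ T.nodes.filter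
      (fun w => T.IsLeaf w ∧ EndsIn true w ∧ w.length < T.height) := by
    intro w hw
    simp only [Finset.mem_image, Finset.mem_univ, true_and] at hw
    obtain ⟨t, rfl⟩ := hw
    have hl := hv.isLeaf t
    simp only [Finset.mem_filter]
    exact ⟨hl.1, hl, hv.endsIn t, lt_of_le_of_ne (length_le_height _ hl.1) (hne t)⟩
  have h2 := Finset.card_le_card h1
  rw [Finset.card_image_of_injective _ hv.injective, Finset.card_univ, Fintype.card_fin] at h2
  have := h2.trans h.card_oneLeaf
  omega

/-- A labelled tree with the structural conditions as a partial tree. -/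
def toPartialTree (h : T.Structural n) (hn : 1 ≤ n) (hv : T.Labels v)
    (hs : ShallowFirst T v) : PartialTree T.height n where
  tree := T
  v := v
  full := h.full
  length_le := length_le_height
  labels := hv
  -- Above the last level there is no 0-leaf by (c), and an unlabelled 1-leaf there would be
  -- shallower than a label on the last level.
  good_of_lt := by
    intro w hw hlt
    by_contra hr
    rcases List.eq_nil_or_concat w with rfl | ⟨u, c, rfl⟩
    · obtain ⟨t, ht⟩ := h.exists_length_eq hn hv
      have ht' := (hv.isLeaf t).1
      cases hvt : v t with
      | nil => simp [hvt] at ht; simp [← ht] at hlt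
      | cons c x =>
        rw [hvt] at ht'
        exact hw.2 c (mem_of_prefix ⟨x, by simp⟩ ht')
    · rw [List.concat_eq_append] at *
      cases c with
      | false => exact absurd (h.zeroLeaf _ hw ⟨u, rfl⟩) hlt.ne
      | true =>
        obtain ⟨t, ht⟩ := h.exists_length_eq hn hv
        have := hs _ hw ⟨u, rfl⟩ hr t
        omega

open Classical in
-- Bad nodes on level `ℓ - 1` are internal, and by (b) they are not 1-nodes; so (e) counts them, and
-- level `ℓ` has at most twice as many. If `ℓ = 1`, the bad node above is the root, and `2 ≤ 2n -
-- 2`.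
theorem badAt_height_le (h : T.Structural n) (hn : 2 ≤ n) (hv : T.Labels v)
    (hs : ShallowFirst T v) : T.badAt v T.height ≤ 2 * n - 2 := by
  set P := h.toPartialTree (by omega) hv hs with hP
  obtain ⟨t, ht⟩ := h.exists_length_eq (by omega) hv
  have hpos : 0 < T.height := by
    rw [← ht]
    refine List.length_pos_iff.2 fun h0 => not_endsIn_nil (h0 ▸ hv.endsIn t)
  obtain ⟨l, hl⟩ : ∃ l, T.height = l + 1 := ⟨T.height - 1, by omega⟩
  have hsucc := P.badAt_succ (j := l) (by omega)
  change T.badAt v (l + 1) + (Finset.univ.filter fun t => (v t).length = l + 1).card =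
    2 * T.badAt v l at hsucc
  cases l with
  | zero =>
    rw [badAt_zero hv] at hsucc
    rw [hl]
    omega
  | succ l =>
    have hbad : T.badAt v (l + 1) ≤ n - 1 := by
      refine le_trans (Finset.card_le_card ?_) h.card_zeroInternal
      intro w hw
      simp only [Finset.mem_filter] at hw ⊢
      have hi : T.IsInternal w := P.isInternal hw.1 (by omega) hw.2.2
      refine ⟨hw.1, hi, ?_, by omega⟩
      rcases List.eq_nil_or_concat w with rfl | ⟨u, c, rfl⟩
      · simp at hw
      · rw [List.concat_eq_append] at *
        cases c with
        | false => exact ⟨u, rfl⟩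
        | true =>
          have := h.oneInternal _ hi ⟨u, rfl⟩
          omega
    rw [hl]
    omega

theorem badAt_le (h : T.Structural n) (hn : 1 ≤ n) (hv : T.Labels v)
    (hs : ShallowFirst T v) {i : ℕ} (hi : i ≤ T.height) : T.badAt v i ≤ 2 * n - 1 := by
  have h1 : T.badAt v i ≤ T.badAt v T.height := (h.toPartialTree hn hv hs).badAt_le_bad hi
  rcases hn.lt_or_eq with hn | rfl
  · have := h.badAt_height_le hn hv hs
    omega
  · refine h1.trans ?_
    set P := h.toPartialTree le_rfl hv hs with hP
    have hl := hv.isLeaf 0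
    obtain ⟨t, ht⟩ := h.exists_length_eq le_rfl hv
    have hpos : 0 < T.height := by
      rw [← ht]
      refine List.length_pos_iff.2 fun h0 => not_endsIn_nil (h0 ▸ hv.endsIn t)
    -- For `n = 1`, (b) and (e) exclude internal nodes on level `ℓ - 1` other than the root. As a
    -- bad one exists there, `ℓ = 1`, and one of the root's two children is labelled.
    have hT : T.height = 1 := by
      by_contra hne
      have hbad := P.one_le_badAt (j := T.height - 1) (by omega)
      obtain ⟨w, hw⟩ := Finset.card_pos.1 (Nat.lt_of_lt_of_le Nat.zero_lt_one hbad)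
      simp only [Finset.mem_filter] at hw
      have hi : T.IsInternal w := P.isInternal hw.1 (by omega) hw.2.2
      rcases List.eq_nil_or_concat w with rfl | ⟨u, c, rfl⟩
      · have := hw.2.1
        simp at this
        omega
      · rw [List.concat_eq_append] at *
        cases c with
        | false =>
          have := h.card_zeroInternal
          simp only [tsub_self, nonpos_iff_eq_zero, Finset.card_eq_zero,
            Finset.filter_eq_empty_iff] at this
          exact this hw.1 ⟨hi, ⟨u, rfl⟩, by omega⟩
        | true =>
          have := h.oneInternal _ hi ⟨u, rfl⟩
          omega
    have hsucc := P.badAt_succ (j := 0) (by omega)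
    change T.badAt v 1 + (Finset.univ.filter fun t => (v t).length = 1).card =
      2 * T.badAt v 0 at hsucc
    rw [badAt_zero hv] at hsucc
    have hc : 0 < (Finset.univ.filter fun t => (v t).length = 1).card :=
      Finset.card_pos.2 ⟨t, Finset.mem_filter.2 ⟨Finset.mem_univ _, ht.trans hT⟩⟩
    rw [hT]
    omega

end CodeTree.Structural

/-! ### Optimal codes -/

section

variable {n : ℕ} {p : Fin n → ℝ}

theorem exists_isOneEndedCode (n : ℕ) : ∃ v : Fin n → List Bool, IsOneEndedCode v := by
  refine ⟨fun t => List.replicate t.val false ++ [true], fun t => ⟨_, rfl⟩, ?_⟩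
  rintro s t hst ⟨x, hx⟩
  have h1 : ((List.replicate s.val false ++ [true]) ++ x)[s.val]? = some true := by simp
  rw [hx] at h1
  rcases lt_trichotomy s.val t.val with h | h | h
  · rw [List.getElem?_append_left (by simpa using h)] at h1
    simp [h] at h1
  · exact hst (Fin.ext h)
  · rw [List.getElem?_eq_none (by simp; omega)] at h1
    simp at h1

/-- Restricting `b` to the bounded range loses nothing. This holds for every code, not only for
optimal ones, so the existence of an optimal code can be deduced from it. -/
theorem exists_OPT_le_cost (hn : 1 ≤ n) (hp : ∀ t, 0 ≤ p t) (hpa : Antitone p)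
    {w : Fin n → List Bool} (hw : IsOneEndedCode w) :
    ∃ b, 1 ≤ b ∧ b ≤ 2 * n - 1 ∧ (2 ≤ n → b ≤ 2 * n - 2) ∧ OPT p n b ≤ cost p w := by
  obtain ⟨l, T, hc, hT, t, ht⟩ := exists_structural hn hp hpa hw
  have hl := height_eq T ht
  refine ⟨T.bad, T.bad_pos, ?_, fun h => ?_, (OPT_le T).trans ?_⟩
  · have := hT.badAt_le hn T.labels T.shallowFirst le_rfl
    rwa [hl] at this
  · have := hT.badAt_height_le h T.labels T.shallowFirst
    rwa [hl] at this
  · rw [T.partialCost_eq_cost]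
    exact EReal.coe_le_coe_iff.2 hc

theorem IsOptimalCode.cost_le_OPT {v : Fin n → List Bool} (hv : IsOptimalCode p v) (b : ℕ) :
    (cost p v : EReal) ≤ OPT p n b := by
  refine le_iInf fun i => le_iInf fun T => le_iInf fun _ => ?_
  rw [T.partialCost_eq_cost]
  exact EReal.coe_le_coe_iff.2 (hv.2 _ T.labels.isOneEndedCode)

theorem isOptimalCode_of_OPT (hn : 1 ≤ n) (hp : ∀ t, 0 ≤ p t) (hpa : Antitone p) {i r : ℕ}
    (T : PartialTree i n) (hT : (T.partialCost p : EReal) = OPT p n r)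
    (hr : ∀ b, 1 ≤ b → b ≤ 2 * n - 1 → OPT p n r ≤ OPT p n b) : IsOptimalCode p T.v := by
  refine ⟨T.labels.isOneEndedCode, fun w hw => ?_⟩
  obtain ⟨b, hb1, hb2, _, hb⟩ := exists_OPT_le_cost hn hp hpa hw
  have := (hr b hb1 hb2).trans hb
  rwa [← hT, T.partialCost_eq_cost, EReal.coe_le_coe_iff] at this

theorem OPT_ne_top_of_min (hn : 1 ≤ n) (hp : ∀ t, 0 ≤ p t) (hpa : Antitone p) {r : ℕ}
    (hr : ∀ b, 1 ≤ b → b ≤ 2 * n - 1 → OPT p n r ≤ OPT p n b) : OPT p n r ≠ ⊤ := by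
  obtain ⟨w, hw⟩ := exists_isOneEndedCode n
  obtain ⟨b, hb1, hb2, _, hb⟩ := exists_OPT_le_cost hn hp hpa hw
  exact (((hr b hb1 hb2).trans hb).trans_lt (EReal.coe_lt_top _)).ne

theorem exists_isOptimalCode (hn : 1 ≤ n) (hp : ∀ t, 0 ≤ p t) (hpa : Antitone p) :
    ∃ v : Fin n → List Bool, IsOptimalCode p v := by
  obtain ⟨r, _, hr⟩ := Finset.exists_min_image (Finset.Icc 1 (2 * n - 1)) (OPT p n)
    ⟨1, by simp; omega⟩
  have hr' : ∀ b, 1 ≤ b → b ≤ 2 * n - 1 → OPT p n r ≤ OPT p n b :=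
    fun b h1 h2 => hr b (by simp [h1, h2])
  obtain ⟨i, T, _, hT⟩ := exists_eq_OPT (OPT_ne_top_of_min hn hp hpa hr')
  exact ⟨T.v, isOptimalCode_of_OPT hn hp hpa T hT.symm hr'⟩

theorem exists_structural_isOptimalCode (hn : 1 ≤ n) (hp : ∀ t, 0 ≤ p t) (hpa : Antitone p) :
    ∃ (T : CodeTree) (v : Fin n → List Bool), IsOptimalCode p v ∧ T.Labels v ∧
      ShallowFirst T v ∧ T.Structural n := by
  obtain ⟨w, hw⟩ := exists_isOptimalCode hn hp hpa
  obtain ⟨l, T, hc, hT, _⟩ := exists_structural hn hp hpa hw.1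
  exact ⟨T.tree, T.v, ⟨T.labels.isOneEndedCode, fun u hu => hc.trans (hw.2 u hu)⟩, T.labels,
    T.shallowFirst, hT⟩

theorem IsOptimalCode.cost_eq_iInf (hn : 1 ≤ n) (hp : ∀ t, 0 ≤ p t) (hpa : Antitone p)
    {v : Fin n → List Bool} (hv : IsOptimalCode p v) :
    (cost p v : EReal) = ⨅ b ∈ Finset.Icc 1 (2 * n - 1), OPT p n b ∧
      (2 ≤ n → (cost p v : EReal) = ⨅ b ∈ Finset.Icc 1 (2 * n - 2), OPT p n b) := by
  obtain ⟨b, hb1, hb2, hb3, hb⟩ := exists_OPT_le_cost hn hp hpa hv.1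
  refine ⟨le_antisymm (le_iInf₂ fun b _ => hv.cost_le_OPT b) ?_,
    fun h2 => le_antisymm (le_iInf₂ fun b _ => hv.cost_le_OPT b) ?_⟩
  · exact iInf₂_le_of_le b (by simp [hb1, hb2]) hb
  · exact iInf₂_le_of_le b (by simp [hb1, hb3 h2]) hb

end

/-! ### Range minima by blocks of equal binary logarithm -/

section Window

theorem log_two_mul {j : ℕ} (hj : j ≠ 0) : Nat.log 2 (2 * j) = Nat.log 2 j + 1 := by
  rw [mul_comm]
  exact Nat.log_mul_base one_lt_two hj

theorem log_two_mul_add_one {j : ℕ} (hj : j ≠ 0) :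
    Nat.log 2 (2 * j + 1) = Nat.log 2 j + 1 := by
  rw [Nat.log_of_one_lt_of_le one_lt_two (by omega)]
  congr 2
  omega

/-- The minimum of `g` over the part below `j` of the block of `j`. -/
noncomputable def prefixMin (g : ℕ → EReal) (j : ℕ) : EReal :=
  ⨅ (i : ℕ) (_ : 1 ≤ i ∧ i ≤ j ∧ Nat.log 2 i = Nat.log 2 j), g i

/-- The minimum of `g` over the part between `j` and `M` of the block of `j`. -/
noncomputable def suffixMin (g : ℕ → EReal) (M j : ℕ) : EReal :=
  ⨅ (i : ℕ) (_ : j ≤ i ∧ i < M ∧ Nat.log 2 i = Nat.log 2 j), g i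

variable {g : ℕ → EReal} {M j : ℕ}

/-- `Nat.log 2 0 = Nat.log 2 1`, so index 0 formally shares the block of 1; the value `∞` makes it a
harmless start of the recursion. -/
theorem prefixMin_zero : prefixMin g 0 = ⊤ := by
  simp only [prefixMin, iInf_eq_top]
  intro i hi
  omega

theorem prefixMin_succ_of_lt (h : Nat.log 2 j < Nat.log 2 (j + 1)) :
    prefixMin g (j + 1) = g (j + 1) := by
  refine le_antisymm (iInf₂_le_of_le (j + 1) ⟨by omega, le_rfl, rfl⟩ le_rfl) ?_
  refine le_iInf₂ fun i hi => ?_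
  rcases Nat.lt_or_eq_of_le hi.2.1 with hlt | rfl
  · have := Nat.log_mono_right (b := 2) (Nat.lt_succ_iff.1 hlt)
    omega
  · exact le_rfl

theorem prefixMin_succ (h : ¬ Nat.log 2 j < Nat.log 2 (j + 1)) :
    prefixMin g (j + 1) = min (prefixMin g j) (g (j + 1)) := by
  have h' : Nat.log 2 j = Nat.log 2 (j + 1) :=
    le_antisymm (Nat.log_mono_right (Nat.le_succ j)) (not_lt.1 h)
  refine eq_of_forall_le_iff fun c => ?_
  simp only [prefixMin, le_iInf_iff, le_min_iff, ← h']
  constructor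
  · intro hc
    exact ⟨fun i hi => hc i ⟨hi.1, by omega, hi.2.2⟩, hc (j + 1) ⟨by omega, le_rfl, h'.symm⟩⟩
  · rintro ⟨h1, h2⟩ i hi
    rcases Nat.lt_or_eq_of_le hi.2.1 with hlt | rfl
    · exact h1 i ⟨hi.1, by omega, hi.2.2⟩
    · exact h2

theorem suffixMin_self : suffixMin g M M = ⊤ := by
  simp only [suffixMin, iInf_eq_top]
  intro i hi
  omega

theorem suffixMin_of_lt (hj : j < M) (h : Nat.log 2 j < Nat.log 2 (j + 1)) :
    suffixMin g M j = g j := by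
  refine le_antisymm (iInf₂_le_of_le j ⟨le_rfl, hj, rfl⟩ le_rfl) ?_
  refine le_iInf₂ fun i hi => ?_
  rcases Nat.lt_or_eq_of_le hi.1 with hlt | rfl
  · have := Nat.log_mono_right (b := 2) hlt
    simp only [Nat.succ_eq_add_one] at this
    omega
  · exact le_rfl

theorem suffixMin_eq_min (hj : j < M) (h : ¬ Nat.log 2 j < Nat.log 2 (j + 1)) :
    suffixMin g M j = min (suffixMin g M (j + 1)) (g j) := by
  have h' : Nat.log 2 j = Nat.log 2 (j + 1) :=
    le_antisymm (Nat.log_mono_right (Nat.le_succ j)) (not_lt.1 h)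
  refine eq_of_forall_le_iff fun c => ?_
  simp only [suffixMin, le_iInf_iff, le_min_iff, ← h']
  constructor
  · intro hc
    exact ⟨fun i hi => hc i ⟨by omega, hi.2⟩, hc j ⟨le_rfl, hj, rfl⟩⟩
  · rintro ⟨h1, h2⟩ i hi
    rcases Nat.lt_or_eq_of_le hi.1 with hlt | rfl
    · exact h1 i ⟨by omega, hi.2⟩
    · exact h2

/-- `gamma p d` extended by `∞` where it is not used. -/
noncomputable def gammaTop {n : ℕ} (p : Fin n → ℝ) (d j : ℕ) : EReal :=
  if 2 * j ≤ d then gamma p d j else ⊤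

/-- The logarithms of `⌈b / 2⌉` and `b` differ by at most 1, so the window meets only the blocks of
its two ends. Conversely neither block part leaves the window: an index beyond `b` is at least `2⌈b
/ 2⌉`, and one below `b / 2` has its double at most `b`, so a violation would change the logarithm.
-/
theorem min_suffixMin_prefixMin {n : ℕ} (p : Fin n → ℝ) {d b M : ℕ} (hd : 2 ≤ d) (hb : 1 ≤ b)
    (hbd : b ≤ d) (hM : b < M) :
    min (suffixMin (gammaTop p d) M ((b + 1) / 2)) (prefixMin (gammaTop p d) b) =
      OPT p (d - b) b := by
  rw [OPT_eq_iInf_gamma hd hb (by omega)]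
  refine eq_of_forall_le_iff fun c => ?_
  simp only [suffixMin, prefixMin, le_iInf_iff, le_min_iff, gammaTop]
  constructor
  · rintro ⟨h1, h2⟩ i ⟨hi1, hi2, hi3⟩
    have hlo : Nat.log 2 ((b + 1) / 2) ≤ Nat.log 2 i := Nat.log_mono_right (by omega)
    have hhi : Nat.log 2 i ≤ Nat.log 2 b := Nat.log_mono_right hi2
    have hstep : Nat.log 2 b ≤ Nat.log 2 ((b + 1) / 2) + 1 := by
      rw [← log_two_mul (by omega)]
      exact Nat.log_mono_right (by omega)
    by_cases h : Nat.log 2 i = Nat.log 2 b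
    · simpa [hi3] using h2 i ⟨by omega, hi2, h⟩
    · simpa [hi3] using h1 i ⟨by omega, by omega, by omega⟩
  · intro h
    constructor
    · rintro i ⟨hi1, _, hi3⟩
      split_ifs with h2
      · refine h i ⟨by omega, ?_, h2⟩
        by_contra! hlt
        have := Nat.log_mono_right (b := 2) (show 2 * ((b + 1) / 2) ≤ i by omega)
        rw [log_two_mul (by omega)] at this
        omega
      · exact le_top
    · rintro i ⟨hi1, hi2, hi3⟩
      split_ifs with h2
      · refine h i ⟨?_, hi2, h2⟩
        by_contra! hlt
        have := Nat.log_mono_right (b := 2) hlt.le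
        rw [log_two_mul (by omega)] at this
        omega
      · exact le_top

end Window

/-! ### Total correctness of programs with time bounds -/

/-- Within `t` steps, `P` started in `s` halts in a state that satisfies `Q`. -/
def HaltsIn (B : ℕ) (P : Prog) (t : ℕ) (Q : State → Prop) (s : State) : Prop :=
  ∃ u s₁, Exec B P s u s₁ ∧ u ≤ t ∧ Q s₁

/-- The results of an instruction fit into words. -/
def Instr.Ok (B : ℕ) : Instr → State → Prop
  | .const _ k, _ => k ≤ B
  | .move _ _, _ => True
  | .add _ y z, s => s.reg y + s.reg z ≤ B
  | .sub _ _ _, _ => True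
  | .mul _ y z, s => s.reg y * s.reg z ≤ B
  | .load _ _ _, _ => True
  | .store _ _ _, _ => True
  | .realZero _ _, _ => True
  | .realInf _ _, _ => True
  | .realMove _ _ _ _, _ => True
  | .realAdd _ _ _ _ _ _, _ => True

/-- The effect of an instruction. -/
noncomputable def Instr.eval : Instr → State → State
  | .const x k, s => s.setReg x k
  | .move x y, s => s.setReg x (s.reg y)
  | .add x y z, s => s.setReg x (s.reg y + s.reg z)
  | .sub x y z, s => s.setReg x (s.reg y - s.reg z)
  | .mul x y z, s => s.setReg x (s.reg y * s.reg z)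
  | .load x a y, s => s.setReg x (s.word a (s.reg y))
  | .store a x y, s => s.setWord a (s.reg x) (s.reg y)
  | .realZero a x, s => s.setReal a (s.reg x) 0
  | .realInf a x, s => s.setReal a (s.reg x) ⊤
  | .realMove a x b y, s => s.setReal a (s.reg x) (s.real b (s.reg y))
  | .realAdd a x b y c z, s =>
    s.setReal a (s.reg x) (s.real b (s.reg y) + s.real c (s.reg z))

theorem Instr.step_eval {B : ℕ} {i : Instr} {s : State} (h : i.Ok B s) :
    Step B i s (i.eval s) := by
  cases i <;> constructor <;> exact h

/-- The weakest precondition of a program without loops. -/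
def Prog.pre (B : ℕ) : Prog → (State → Prop) → State → Prop
  | .nop, Q => Q
  | .instr i, Q => fun s => i.Ok B s ∧ Q (i.eval s)
  | .seq P P', Q => P.pre B (P'.pre B Q)
  | .ite c P P', Q => fun s => (c.Holds s → P.pre B Q s) ∧ (¬ c.Holds s → P'.pre B Q s)
  | .loop _ _, _ => fun _ => False

/-- A bound on the number of steps of a program without loops. -/
def Prog.time : Prog → ℕ
  | .nop => 1
  | .instr _ => 1
  | .seq P Q => P.time + Q.time
  | .ite _ P Q => P.time + Q.time + 1
  | .loop _ _ => 0

/-- The program that executes the given programs one after the other. -/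
def block : List Prog → Prog
  | [] => .nop
  | P :: l => .seq P (block l)

instance : Coe Instr Prog := ⟨Prog.instr⟩

section HaltsIn

variable {B : ℕ} {P P' : Prog} {t t' : ℕ} {Q Q' : State → Prop} {s : State}

theorem HaltsIn.mono (h : HaltsIn B P t Q s) (hQ : ∀ s, Q s → Q' s) (ht : t ≤ t') :
    HaltsIn B P t' Q' s := by
  obtain ⟨u, s', he, hu, hs⟩ := h
  exact ⟨u, s', he, hu.trans ht, hQ s' hs⟩

theorem haltsIn_seq (h : HaltsIn B P t (HaltsIn B P' t' Q) s) :
    HaltsIn B (.seq P P') (t + t') Q s := by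
  obtain ⟨u, s', he, hu, u', s'', he', hu', hs⟩ := h
  exact ⟨u + u', s'', .seq he he', by omega, hs⟩

theorem haltsIn_of_pre (h : P.pre B Q s) : HaltsIn B P P.time Q s := by
  induction P generalizing Q s with
  | nop => exact ⟨1, s, .nop s, le_rfl, h⟩
  | instr i => exact ⟨1, _, .instr (Instr.step_eval h.1), le_rfl, h.2⟩
  | seq P P' ih ih' => exact haltsIn_seq ((ih h).mono (fun _ => ih') le_rfl)
  | ite c P P' ih ih' =>
    by_cases hc : c.Holds s
    · obtain ⟨u, s', he, hu, hs⟩ := ih (h.1 hc)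
      exact ⟨u + 1, s', .iteTrue hc he, by simp only [Prog.time]; omega, hs⟩
    · obtain ⟨u, s', he, hu, hs⟩ := ih' (h.2 hc)
      exact ⟨u + 1, s', .iteFalse hc he, by simp only [Prog.time]; omega, hs⟩
  | loop c P => exact h.elim

theorem haltsIn_instr_seq {i : Instr} (hi : i.Ok B s) (h : HaltsIn B P t Q (i.eval s)) :
    HaltsIn B (.seq (.instr i) P) (t + 1) Q s := by
  rw [add_comm]
  exact haltsIn_seq ⟨1, _, .instr (Instr.step_eval hi), le_rfl, h⟩

theorem haltsIn_block_nil (h : Q s) : HaltsIn B (block []) 1 Q s := ⟨1, s, .nop s, le_rfl, h⟩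

/-- The variant `μ` allows at most `N` rounds. Each costs a test and a body, and the last test
fails. -/
theorem haltsIn_loop {c : Test} (I : State → Prop) (μ : State → ℕ)
    (h : ∀ s, I s → c.Holds s → HaltsIn B P t (fun s' => I s' ∧ μ s' < μ s) s)
    (hI : I s) {N : ℕ} (hN : μ s ≤ N) :
    HaltsIn B (.loop c P) (N * (t + 1) + 1) (fun s' => I s' ∧ ¬ c.Holds s') s := by
  induction N generalizing s with
  | zero =>
    by_cases hc : c.Holds s
    · obtain ⟨_, s', _, _, _, hμ⟩ := h s hI hc
      omega
    · exact ⟨1, s, .loopFalse hc, by omega, hI, hc⟩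
  | succ N ih =>
    by_cases hc : c.Holds s
    · obtain ⟨u, s', he, hu, hI', hμ⟩ := h s hI hc
      obtain ⟨u', s'', he', hu', hs⟩ := ih hI' (by omega)
      refine ⟨u + u' + 1, s'', .loopTrue hc he he', ?_, hs⟩
      rw [add_mul]
      omega
    · exact ⟨1, s, .loopFalse hc, by omega, hI, hc⟩

end HaltsIn

/-! ### Reading a state after an update -/

section State

variable (s : State) (x y a b i j k : ℕ) (r : EReal)

@[simp] theorem State.setReg_reg :
    (s.setReg x k).reg y = if y = x then k else s.reg y := by
  simp [State.setReg, Function.update_apply]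

@[simp] theorem State.setReg_word : (s.setReg x k).word = s.word := rfl

@[simp] theorem State.setReg_real : (s.setReg x k).real = s.real := rfl

@[simp] theorem State.setWord_reg : (s.setWord a i k).reg = s.reg := rfl

@[simp] theorem State.setWord_word :
    (s.setWord a i k).word b j = if b = a ∧ j = i then k else s.word b j := by
  by_cases h : b = a
  · subst h
    simp [State.setWord, Function.update_apply]
  · simp [State.setWord, h]

@[simp] theorem State.setWord_real : (s.setWord a i k).real = s.real := rfl

@[simp] theorem State.setReal_reg : (s.setReal a i r).reg = s.reg := rfl

@[simp] theorem State.setReal_word : (s.setReal a i r).word = s.word := rfl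

@[simp] theorem State.setReal_real :
    (s.setReal a i r).real b j = if b = a ∧ j = i then r else s.real b j := by
  by_cases h : b = a
  · subst h
    simp [State.setReal, Function.update_apply]
  · simp [State.setReal, h]

end State

/-! ### The program -/

open Instr

/-- `W` into real array 3, and the constants into registers 1 to 4. -/
def weightProg : Prog := block [const 1 1, add 2 0 0, add 4 2 0, move 6 0,
  .loop (.lt 3 6) (block [sub 7 6 1, realAdd 3 7 0 7 3 6, move 6 7])]

/-- The binary logarithms into word array 2, the rounded halves into word array 3. -/
def logProg : Prog := block [const 6 1,
  .loop (.lt 6 2) (block [load 7 2 6, add 7 7 1, add 8 6 6, store 2 8 7, sub 9 8 1, store 3 9 6,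
    store 3 8 6, add 8 8 1, store 2 8 7, add 6 6 1])]

/-- `gamma p d` into real array 4. -/
def gammaProg : Prog := block [const 6 1,
  .loop (.lt 6 2) (block [add 7 6 6,
    .ite (.lt 5 7) (realInf 4 6)
      (block [sub 8 5 7, mul 9 8 2, add 9 9 6, realAdd 4 6 1 9 3 8]),
    add 6 6 1])]

/-- The prefix minima of real array 4 into real array 5. -/
def prefixProg : Prog := block [realInf 5 3, const 6 1,
  .loop (.lt 6 2) (block [sub 7 6 1, load 8 2 7, load 9 2 6, realMove 5 6 4 6,
    .ite (.lt 8 9) .nop (.ite (.realLe 5 7 5 6) (realMove 5 6 5 7) .nop),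
    add 6 6 1])]

/-- The suffix minima of real array 4 into real array 6. -/
def suffixProg : Prog := block [realInf 6 2, move 6 2,
  .loop (.lt 1 6) (block [sub 7 6 1, load 8 2 7, load 9 2 6, realMove 6 7 4 7,
    .ite (.lt 8 9) .nop (.ite (.realLe 6 6 6 7) (realMove 6 7 6 6) .nop),
    move 6 7])]

/-- The table entries with `m + b = d`. -/
def fillProg : Prog := block [mul 8 5 2, realInf 1 8, const 6 1,
  .loop (.lt 6 2) (block [
    .ite (.lt 5 6) .nop (block [sub 7 5 6, mul 8 7 2, add 8 8 6, load 9 3 6,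
      .ite (.realLe 6 9 5 6) (realMove 1 8 6 9) (realMove 1 8 5 6)]),
    add 6 6 1])]

/-- The whole table. -/
def tableProg : Prog := block [realInf 1 3, realZero 1 1, realInf 1 2, const 5 2,
  .loop (.lt 5 4) (block [gammaProg, prefixProg, suffixProg, fillProg, add 5 5 1])]

/-- The minimum of the row `n` into cell 0 of real array 2, its place into register 13. -/
def minProg : Prog := block [mul 9 0 2, add 8 9 1, const 13 1, realMove 2 3 1 8, const 6 2,
  .loop (.lt 6 2) (block [add 8 9 6,
    .ite (.realLe 2 3 1 8) .nop (block [realMove 2 3 1 8, move 13 6]),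
    add 6 6 1])]

/-- A minimizer of the recurrence for the signature in registers 10 and 11 into register 13. -/
def scanProg : Prog := block [mul 9 10 2, add 9 9 11, const 6 1,
  .loop (.lt 6 2) (block [add 7 6 6,
    .ite (.lt 11 6) .nop (.ite (.lt 7 11) .nop (.ite (.lt 5 7) .nop
      (block [sub 8 5 7, mul 14 8 2, add 14 14 6, realAdd 4 3 1 14 3 8,
        .ite (.realLe 4 3 1 9) (move 13 6) .nop]))),
    add 6 6 1])]

/-- The reversed sequence of signatures into word arrays 4 and 5. -/
def backProg : Prog := block [move 10 0, move 11 13, const 12 0, store 4 12 10, store 5 12 11,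
  add 5 10 11,
  .loop (.lt 1 5) (block [scanProg, add 7 13 13, sub 10 5 7, move 11 13, add 12 12 1,
    store 4 12 10, store 5 12 11, add 5 10 11])]

/-- The sequence of signatures into word arrays 0 and 1. -/
def reverseProg : Prog := block [const 6 0, add 7 12 1,
  .loop (.lt 6 7) (block [sub 8 12 6, load 9 4 8, store 0 6 9, load 9 5 8, store 1 6 9,
    add 6 6 1]),
  move 0 12]

def mainProg : Prog :=
  block [weightProg, logProg, tableProg, minProg, backProg, reverseProg]

/-! ### Correctness of the program -/

section Correctness

variable {n : ℕ} {p : Fin n → ℝ}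

/-- The part of the state that the program leaves alone after the initial phases. -/
structure Ctx (p : Fin n → ℝ) (s : State) : Prop where
  reg0 : s.reg 0 = n
  reg1 : s.reg 1 = 1
  reg2 : s.reg 2 = 2 * n
  reg3 : s.reg 3 = 0
  reg4 : s.reg 4 = 3 * n
  weight : ∀ m, s.real 3 m = (W p m : EReal)
  log : ∀ j ≤ 2 * n, s.word 2 j = Nat.log 2 j
  half : ∀ j ≤ 2 * n, s.word 3 j = (j + 1) / 2

/-- The table entries with `m + b < d`, or `m + b = d` and `b < j`, are in place. -/
def Filled (p : Fin n → ℝ) (d j : ℕ) (s : State) : Prop :=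
  ∀ m b, b < 2 * n → (m + b < d ∨ m + b = d ∧ b < j) → s.real 1 (m * (2 * n) + b) = OPT p m b

/-- Real array `a` holds `f` between `lo` and `hi`. -/
def Holds (a lo hi : ℕ) (f : ℕ → EReal) (s : State) : Prop :=
  ∀ j, lo ≤ j → j < hi → s.real a j = f j

variable {s : State} {x a k i d lo hi : ℕ} {r : EReal} {f : ℕ → EReal}

@[simp] theorem ctx_setReg (hx : 4 < x) : Ctx p (s.setReg x k) ↔ Ctx p s := by
  constructor <;> rintro ⟨h0, h1, h2, h3, h4, h5, h6, h7⟩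
  · have h : ∀ y < 5, (s.setReg x k).reg y = s.reg y := fun y hy => by
      simp [show y ≠ x by omega]
    exact ⟨(h 0 (by omega)).symm.trans h0, (h 1 (by omega)).symm.trans h1,
      (h 2 (by omega)).symm.trans h2, (h 3 (by omega)).symm.trans h3,
      (h 4 (by omega)).symm.trans h4, h5, h6, h7⟩
  · constructor <;> (try assumption) <;> rw [State.setReg_reg, if_neg (by omega)] <;> assumption

@[simp] theorem ctx_setReal (ha : a ≠ 3) : Ctx p (s.setReal a i r) ↔ Ctx p s := by
  have h : ∀ m, (s.setReal a i r).real 3 m = s.real 3 m := fun m => by simp [ha.symm]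
  constructor <;> rintro ⟨h0, h1, h2, h3, h4, h5, h6, h7⟩
  · exact ⟨h0, h1, h2, h3, h4, fun m => by rw [← h, h5], h6, h7⟩
  · exact ⟨h0, h1, h2, h3, h4, fun m => by rw [h, h5], h6, h7⟩

@[simp] theorem ctx_setWord (ha : 3 < a) : Ctx p (s.setWord a i k) ↔ Ctx p s := by
  have h : ∀ b < 4, ∀ m, (s.setWord a i k).word b m = s.word b m := fun b hb m => by
    simp [show b ≠ a by omega]
  constructor <;> rintro ⟨h0, h1, h2, h3, h4, h5, h6, h7⟩
  · exact ⟨h0, h1, h2, h3, h4, h5, fun m hm => by rw [← h 2 (by omega), h6 m hm],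
      fun m hm => by rw [← h 3 (by omega), h7 m hm]⟩
  · exact ⟨h0, h1, h2, h3, h4, h5, fun m hm => by rw [h 2 (by omega), h6 m hm],
      fun m hm => by rw [h 3 (by omega), h7 m hm]⟩

@[simp] theorem filled_setReg {j : ℕ} : Filled p d j (s.setReg x k) ↔ Filled p d j s := Iff.rfl

@[simp] theorem filled_setWord {j : ℕ} : Filled p d j (s.setWord a i k) ↔ Filled p d j s :=
  Iff.rfl

@[simp] theorem filled_setReal {j : ℕ} (ha : a ≠ 1) :
    Filled p d j (s.setReal a i r) ↔ Filled p d j s := by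
  simp [Filled, ha.symm]

@[simp] theorem holds_setReg : Holds a lo hi f (s.setReg x k) ↔ Holds a lo hi f s := Iff.rfl

@[simp] theorem holds_setReal {c : ℕ} (ha : a ≠ c) :
    Holds a lo hi f (s.setReal c i r) ↔ Holds a lo hi f s := by
  simp [Holds, ha]

theorem Holds.set (h : Holds a lo hi f s) (hr : r = f hi) :
    Holds a lo (hi + 1) f (s.setReal a hi r) := by
  intro j h1 h2
  by_cases hj : j = hi
  · subst hj
    simp [hr]
  · simpa [hj] using h j h1 (by omega)

theorem Holds.set_left (h : Holds a (lo + 1) hi f s) (hr : r = f lo) :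
    Holds a lo hi f (s.setReal a lo r) := by
  intro j h1 h2
  by_cases hj : j = lo
  · subst hj
    simp [hr]
  · simpa [hj] using h j (by omega) h2

theorem Holds.set_ge (h : Holds a lo hi f s) (hi' : hi ≤ i) :
    Holds a lo hi f (s.setReal a i r) := by
  intro j h1 h2
  simpa [show j ≠ i by omega] using h j h1 h2

theorem Holds.set_lt (h : Holds a lo hi f s) (hi' : i < lo) :
    Holds a lo hi f (s.setReal a i r) := by
  intro j h1 h2
  simpa [show j ≠ i by omega] using h j h1 h2

/-- Distinct table entries occupy distinct cells in the layout by rows. -/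
theorem mul_add_injective {N m b m' b' : ℕ} (hb : b < N) (hb' : b' < N)
    (h : m * N + b = m' * N + b') : m = m' ∧ b = b' := by
  have h1 : (m * N + b) / N = m := by
    rw [add_comm, Nat.add_mul_div_right _ _ (by omega), Nat.div_eq_of_lt hb, zero_add]
  have h2 : (m' * N + b') / N = m' := by
    rw [add_comm, Nat.add_mul_div_right _ _ (by omega), Nat.div_eq_of_lt hb', zero_add]
  have h3 : m = m' := by rw [← h1, h, h2]
  subst h3
  exact ⟨rfl, by omega⟩

theorem Filled.set {j : ℕ} (h : Filled p d j s) (hj : j < 2 * n) (hjd : j ≤ d)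
    (hr : r = OPT p (d - j) j) :
    Filled p d (j + 1) (s.setReal 1 ((d - j) * (2 * n) + j) r) := by
  intro m b hb hmb
  by_cases hq : b = j ∧ m = d - j
  · obtain ⟨rfl, rfl⟩ := hq
    simp [hr]
  · have : m * (2 * n) + b ≠ (d - j) * (2 * n) + j := fun h' => by
      have := mul_add_injective hb hj h'
      omega
    simpa [this] using h m b hb (by omega)

theorem Filled.skip {j : ℕ} (h : Filled p d j s) (hjd : d < j) : Filled p d (j + 1) s :=
  fun m b hb hmb => h m b hb (by omega)

variable {B : ℕ}

/-- In `hB`, the first summand bounds the row addresses, as all rows in use are below `3 * n`; the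
second leaves room for columns and counters. `Filled` includes rows beyond `n`, where the recurrence
holds as well. -/
theorem gammaProg_spec (hn : 1 ≤ n) (hB : 3 * n * (2 * n) + 20 * n ≤ B) (hd : d < 3 * n)
    (hs : Ctx p s ∧ Filled p d 0 s ∧ s.reg 5 = d) :
    HaltsIn B gammaProg (100 * n) (fun s => (Ctx p s ∧ Filled p d 0 s ∧ s.reg 5 = d) ∧
      Holds 4 1 (2 * n) (gammaTop p d) s) s := by
  refine (haltsIn_instr_seq (t := 2 * n * 31 + 1 + 1) ?_ (haltsIn_seq ?_)).mono
    (fun _ h => h) (by omega)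
  · simp only [Instr.Ok]; omega
  refine (haltsIn_loop (fun s => (Ctx p s ∧ Filled p d 0 s ∧ s.reg 5 = d) ∧
    (1 ≤ s.reg 6 ∧ s.reg 6 ≤ 2 * n) ∧ Holds 4 1 (s.reg 6) (gammaTop p d) s)
    (fun s => 2 * n - s.reg 6) (t := 30) ?_ ?_ (N := 2 * n) (Nat.sub_le _ _)).mono ?_ le_rfl
  · rintro s ⟨⟨hc, hT, h5⟩, ⟨h6, h6'⟩, hH⟩ hlt
    have h2 := hc.reg2
    have h1 := hc.reg1
    obtain ⟨j, hj⟩ : ∃ j, s.reg 6 = j := ⟨_, rfl⟩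
    simp only [Test.Holds, h2, hj] at hlt h6 h6' hH
    have hm : (d - (j + j)) * (2 * n) ≤ 3 * n * (2 * n) := Nat.mul_le_mul_right _ (by omega)
    refine (haltsIn_of_pre ?_).mono (fun _ h => h) (show Prog.time _ ≤ 30 by decide)
    simp [block, Prog.pre, Instr.Ok, Instr.eval, Test.Holds, h1, h2, h5, hj, hc, hT]
    refine ⟨by omega, fun hdj => ⟨by omega, ⟨by omega, Holds.set hH ?_⟩, by omega⟩,
      fun hdj => ⟨by omega, by omega, by omega, ⟨by omega, Holds.set hH ?_⟩, by omega⟩⟩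
    · rw [gammaTop, if_neg (by omega)]
    -- The entry `(d - 2j, j)` lies on the diagonal `d - j`, which is complete because `j ≥ 1`.
    · rw [gammaTop, if_pos (by omega), gamma, two_mul j, hc.weight,
        hT _ _ hlt (Or.inl (by omega))]
  · refine ⟨by simp [Instr.eval, hs], by simp [Instr.eval]; omega, ?_⟩
    intro j h1 h2
    simp [Instr.eval] at h2
    omega
  · rintro s ⟨⟨hs, ⟨_, h6⟩, hH⟩, hlt⟩
    simp only [Test.Holds, hs.1.reg2] at hlt
    exact haltsIn_block_nil ⟨hs, by rwa [show s.reg 6 = 2 * n by omega] at hH⟩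

theorem prefixProg_spec (hn : 1 ≤ n) (hB : 3 * n * (2 * n) + 20 * n ≤ B) {g : ℕ → EReal}
    (hs : (Ctx p s ∧ Filled p d 0 s ∧ s.reg 5 = d) ∧ Holds 4 1 (2 * n) g s) :
    HaltsIn B prefixProg (100 * n) (fun s => ((Ctx p s ∧ Filled p d 0 s ∧ s.reg 5 = d) ∧
      Holds 4 1 (2 * n) g s) ∧ Holds 5 0 (2 * n) (prefixMin g) s) s := by
  refine (haltsIn_instr_seq (t := 2 * n * 31 + 1 + 1 + 1) (by trivial)
    (haltsIn_instr_seq ?_ (haltsIn_seq ?_))).mono (fun _ h => h) (by omega)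
  · simp only [Instr.Ok]; omega
  refine (haltsIn_loop (fun s => ((Ctx p s ∧ Filled p d 0 s ∧ s.reg 5 = d) ∧
    Holds 4 1 (2 * n) g s) ∧ (1 ≤ s.reg 6 ∧ s.reg 6 ≤ 2 * n) ∧
    Holds 5 0 (s.reg 6) (prefixMin g) s)
    (fun s => 2 * n - s.reg 6) (t := 30) ?_ ?_ (N := 2 * n) (Nat.sub_le _ _)).mono ?_ le_rfl
  · rintro s ⟨⟨⟨hc, hT, h5⟩, hg⟩, ⟨h6, h6'⟩, hH⟩ hlt
    have h2 := hc.reg2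
    have h1 := hc.reg1
    obtain ⟨j, hj⟩ : ∃ j, s.reg 6 = j + 1 := ⟨s.reg 6 - 1, by omega⟩
    simp only [Test.Holds, h2, hj] at hlt h6 h6' hH
    refine (haltsIn_of_pre ?_).mono (fun _ h => h) (show Prog.time _ ≤ 30 by decide)
    simp [block, Prog.pre, Instr.Ok, Instr.eval, Test.Holds, h1, h5, hj, hc, hT, hg,
      hc.log j (by omega), hc.log (j + 1) (by omega), hH j (by omega) (by omega),
      hg (j + 1) (by omega) hlt]
    refine ⟨fun hl => ⟨by omega, ⟨by omega, Holds.set hH ?_⟩, by omega⟩,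
      fun hl => ⟨fun hle => ⟨by omega, ⟨by omega, Holds.set (Holds.set_ge hH le_rfl) ?_⟩,
        by omega⟩, fun hle => ⟨by omega, ⟨by omega, Holds.set hH ?_⟩, by omega⟩⟩⟩
    · rw [prefixMin_succ_of_lt hl]
    · rw [prefixMin_succ (not_lt.2 hl), min_eq_left hle]
    · rw [prefixMin_succ (not_lt.2 hl), min_eq_right hle.le]
  · have h3 := hs.1.1.reg3
    refine ⟨by simp [Instr.eval, hs], by simp [Instr.eval]; omega, ?_⟩
    intro j _ hj
    simp [Instr.eval] at hj
    subst hj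
    simp [Instr.eval, h3, prefixMin_zero]
  · rintro s ⟨⟨hs, ⟨_, h6⟩, hH⟩, hlt⟩
    simp only [Test.Holds, hs.1.1.reg2] at hlt
    exact haltsIn_block_nil ⟨hs, by rwa [show s.reg 6 = 2 * n by omega] at hH⟩

theorem suffixProg_spec (hn : 1 ≤ n) {g : ℕ → EReal}
    (hs : ((Ctx p s ∧ Filled p d 0 s ∧ s.reg 5 = d) ∧ Holds 4 1 (2 * n) g s) ∧
      Holds 5 0 (2 * n) (prefixMin g) s) :
    HaltsIn B suffixProg (100 * n) (fun s => (((Ctx p s ∧ Filled p d 0 s ∧ s.reg 5 = d) ∧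
      Holds 4 1 (2 * n) g s) ∧ Holds 5 0 (2 * n) (prefixMin g) s) ∧
      Holds 6 1 (2 * n + 1) (suffixMin g (2 * n)) s) s := by
  refine (haltsIn_instr_seq (t := 2 * n * 31 + 1 + 1 + 1) (by trivial)
    (haltsIn_instr_seq (by trivial) (haltsIn_seq ?_))).mono (fun _ h => h) (by omega)
  refine (haltsIn_loop (fun s => (((Ctx p s ∧ Filled p d 0 s ∧ s.reg 5 = d) ∧
    Holds 4 1 (2 * n) g s) ∧ Holds 5 0 (2 * n) (prefixMin g) s) ∧
    (1 ≤ s.reg 6 ∧ s.reg 6 ≤ 2 * n) ∧ Holds 6 (s.reg 6) (2 * n + 1) (suffixMin g (2 * n)) s)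
    (fun s => s.reg 6) (t := 30) ?_ ?_ (N := 2 * n) ?_).mono ?_ le_rfl
  · rintro s ⟨⟨⟨⟨hc, hT, h5⟩, hg⟩, hP⟩, ⟨h6, h6'⟩, hH⟩ hlt
    have h2 := hc.reg2
    have h1 := hc.reg1
    obtain ⟨j, hj⟩ : ∃ j, s.reg 6 = j + 1 := ⟨s.reg 6 - 1, by omega⟩
    simp only [Test.Holds, h1, hj] at hlt h6 h6' hH
    refine (haltsIn_of_pre ?_).mono (fun _ h => h) (show Prog.time _ ≤ 30 by decide)
    simp [block, Prog.pre, Instr.Ok, Instr.eval, Test.Holds, h1, h5, hj, hc, hT, hg, hP,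
      hc.log j (by omega), hc.log (j + 1) (by omega), hH (j + 1) (by omega) (by omega),
      hg j (by omega) (by omega)]
    refine ⟨fun hl => ⟨⟨by omega, by omega⟩, Holds.set_left hH ?_⟩,
      fun hl => ⟨fun hle => ⟨⟨by omega, by omega⟩,
        Holds.set_left (Holds.set_lt hH (Nat.lt_succ_self j)) ?_⟩,
        fun hle => ⟨⟨by omega, by omega⟩, Holds.set_left hH ?_⟩⟩⟩
    · rw [suffixMin_of_lt (by omega) hl]
    · rw [suffixMin_eq_min (by omega) (not_lt.2 hl), min_eq_left hle]
    · rw [suffixMin_eq_min (by omega) (not_lt.2 hl), min_eq_right hle.le]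
  · have h2 := hs.1.1.1.reg2
    refine ⟨by simp [Instr.eval, hs], by simp [Instr.eval, h2]; omega, ?_⟩
    intro j hj hj'
    simp [Instr.eval, h2] at hj
    obtain rfl : j = 2 * n := by omega
    simp [Instr.eval, h2, suffixMin_self]
  · simp [Instr.eval, hs.1.1.1.reg2]
  · rintro s ⟨⟨hs, ⟨h6, _⟩, hH⟩, hlt⟩
    simp only [Test.Holds, hs.1.1.1.reg1] at hlt
    exact haltsIn_block_nil ⟨hs, by rwa [show s.reg 6 = 1 by omega] at hH⟩

theorem fillProg_spec (hn : 1 ≤ n) (hB : 3 * n * (2 * n) + 20 * n ≤ B) (hd2 : 2 ≤ d)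
    (hd : d < 3 * n)
    (hs : (((Ctx p s ∧ Filled p d 0 s ∧ s.reg 5 = d) ∧ Holds 4 1 (2 * n) (gammaTop p d) s) ∧
      Holds 5 0 (2 * n) (prefixMin (gammaTop p d)) s) ∧
      Holds 6 1 (2 * n + 1) (suffixMin (gammaTop p d) (2 * n)) s) :
    HaltsIn B fillProg (100 * n)
      (fun s => Ctx p s ∧ Filled p (d + 1) 0 s ∧ s.reg 5 = d) s := by
  obtain ⟨⟨⟨⟨hc, hT, h5⟩, -⟩, hP⟩, hS⟩ := hs
  have hm : d * (2 * n) ≤ 3 * n * (2 * n) := Nat.mul_le_mul_right _ hd.le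
  refine (haltsIn_instr_seq (t := 2 * n * 31 + 1 + 1 + 1 + 1) ?_ (haltsIn_instr_seq (by trivial)
    (haltsIn_instr_seq ?_ (haltsIn_seq ?_)))).mono (fun _ h => h) (by omega)
  · simp only [Instr.Ok, h5, hc.reg2]; omega
  · simp only [Instr.Ok]; omega
  refine (haltsIn_loop (fun s => (Ctx p s ∧ s.reg 5 = d ∧
    Holds 5 0 (2 * n) (prefixMin (gammaTop p d)) s ∧
    Holds 6 1 (2 * n + 1) (suffixMin (gammaTop p d) (2 * n)) s) ∧
    (1 ≤ s.reg 6 ∧ s.reg 6 ≤ 2 * n) ∧ Filled p d (s.reg 6) s)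
    (fun s => 2 * n - s.reg 6) (t := 30) ?_ ?_ (N := 2 * n) (Nat.sub_le _ _)).mono ?_ le_rfl
  · clear hc hT h5 hP hS
    rintro s ⟨⟨hc, h5, hP, hS⟩, ⟨h6, h6'⟩, hT⟩ hlt
    have h2 := hc.reg2
    have h1 := hc.reg1
    obtain ⟨j, hj⟩ : ∃ j, s.reg 6 = j := ⟨_, rfl⟩
    simp only [Test.Holds, h2, hj] at hlt h6 h6' hT
    have hm : (d - j) * (2 * n) ≤ 3 * n * (2 * n) := Nat.mul_le_mul_right _ (by omega)
    refine (haltsIn_of_pre ?_).mono (fun _ h => h) (show Prog.time _ ≤ 30 by decide)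
    simp [block, Prog.pre, Instr.Ok, Instr.eval, Test.Holds, h1, h2, h5, hj, hc, hP, hS,
      hc.half j (by omega), hP j (by omega) hlt, hS ((j + 1) / 2) (by omega) (by omega)]
    refine ⟨fun hdj => ⟨by omega, ⟨by omega, hT.skip hdj⟩, by omega⟩,
      fun hdj => ⟨by omega, by omega, fun hle => ⟨by omega, ⟨by omega, ?_⟩, by omega⟩,
        fun hle => ⟨by omega, ⟨by omega, ?_⟩, by omega⟩⟩⟩
    · refine Filled.set hT hlt hdj ?_
      rw [← min_suffixMin_prefixMin p hd2 h6 hdj hlt, min_eq_left hle]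
    · refine Filled.set hT hlt hdj ?_
      rw [← min_suffixMin_prefixMin p hd2 h6 hdj hlt, min_eq_right hle.le]
  · refine ⟨by simp [Instr.eval, hc, h5, hP, hS], by simp [Instr.eval]; omega, ?_⟩
    simp only [Instr.eval, State.setReg_reg, h5, hc.reg2, if_true, filled_setReg]
    -- Column 0 is `∞`, since every partial tree has a bad node on its last level.
    have := Filled.set (s := s.setReg 8 (d * (2 * n))) (r := ⊤) (j := 0) hT (by omega) (by omega)
      (OPT_bad_zero _).symm
    simpa using this
  · rintro s ⟨⟨⟨hc, h5, _⟩, ⟨_, h6⟩, hT⟩, hlt⟩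
    simp only [Test.Holds, hc.reg2] at hlt
    rw [show s.reg 6 = 2 * n by omega] at hT
    exact haltsIn_block_nil ⟨hc, fun m b hb hmb => hT m b hb (by omega), h5⟩

theorem tableProg_spec (hn : 1 ≤ n) (hB : 3 * n * (2 * n) + 20 * n ≤ B) (hp : ∀ t, 0 ≤ p t)
    (hs : Ctx p s) :
    HaltsIn B tableProg (2000 * n ^ 2) (fun s => Ctx p s ∧ Filled p (3 * n) 0 s) s := by
  have hn2 : n ≤ n ^ 2 := Nat.le_self_pow two_ne_zero n
  have h1 := hs.reg1
  have h2 := hs.reg2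
  have h3 := hs.reg3
  refine (haltsIn_instr_seq (t := 3 * n * (400 * n + 2 + 1) + 1 + 1 + 1 + 1 + 1) (by trivial)
    (haltsIn_instr_seq (by trivial) (haltsIn_instr_seq (by trivial)
      (haltsIn_instr_seq ?_ (haltsIn_seq ?_))))).mono (fun _ h => h) (by nlinarith)
  · simp only [Instr.Ok]; omega
  refine (haltsIn_loop (fun s => (2 ≤ s.reg 5 ∧ s.reg 5 ≤ 3 * n) ∧ Ctx p s ∧
    Filled p (s.reg 5) 0 s) (fun s => 3 * n - s.reg 5) (t := 400 * n + 2) ?_ ?_ (N := 3 * n)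
    (Nat.sub_le _ _)).mono ?_ le_rfl
  · rintro s ⟨⟨h5, _⟩, hc, hT⟩ hlt
    simp only [Test.Holds, hc.reg4] at hlt
    refine HaltsIn.mono (haltsIn_seq (t := 100 * n) (t' := 300 * n + 2)
      ((gammaProg_spec hn hB hlt ⟨hc, hT, rfl⟩).mono (fun s₁ hs₁ => ?_) le_rfl)) (fun _ h => h)
      (by omega)
    refine HaltsIn.mono (haltsIn_seq (t := 100 * n) (t' := 200 * n + 2)
      ((prefixProg_spec hn hB hs₁).mono (fun s₂ hs₂ => ?_) le_rfl)) (fun _ h => h)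
      (by omega)
    refine HaltsIn.mono (haltsIn_seq (t := 100 * n) (t' := 100 * n + 2)
      ((suffixProg_spec hn hs₂).mono (fun s₃ hs₃ => ?_) le_rfl)) (fun _ h => h)
      (by omega)
    refine HaltsIn.mono (haltsIn_seq (t := 100 * n) (t' := 2)
      ((fillProg_spec hn hB h5 hlt hs₃).mono (fun s₄ hs₄ => ?_) le_rfl)) (fun _ h => h)
      (by omega)
    obtain ⟨hc₄, hT₄, h5₄⟩ := hs₄
    refine (haltsIn_of_pre ?_).mono (fun _ h => h) (show Prog.time _ ≤ 2 by decide)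
    simp [block, Prog.pre, Instr.Ok, Instr.eval, h5₄, hc₄.reg1, hc₄, hT₄]
    omega
  · refine ⟨by simp [Instr.eval]; omega, by simp [Instr.eval, hs], ?_⟩
    intro m b hb hmb
    -- Batching needs `d ≥ 2`, so the three entries on the diagonals 0 and 1 are initialized
    -- directly.
    have hmb' : (m = 0 ∧ b = 0) ∨ (m = 0 ∧ b = 1) ∨ (m = 1 ∧ b = 0) := by
      simp [Instr.eval] at hmb
      omega
    rcases hmb' with ⟨rfl, rfl⟩ | ⟨rfl, rfl⟩ | ⟨rfl, rfl⟩
    · simp [Instr.eval, h1, h2, h3, OPT_bad_zero]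
    · simp [Instr.eval, h1, h2, h3, OPT_zero_one hp]
      omega
    · simp [Instr.eval, h1, h2, h3, OPT_bad_zero]
  · rintro s ⟨⟨⟨_, h5⟩, hc, hT⟩, hlt⟩
    simp only [Test.Holds, hc.reg4] at hlt
    exact haltsIn_block_nil ⟨hc, by rwa [show s.reg 5 = 3 * n by omega] at hT⟩

theorem W_of_le {m : ℕ} (hm : n ≤ m) : W p m = 0 :=
  Finset.sum_eq_zero fun t _ => if_neg (by omega)

theorem W_eq_add {m : ℕ} (hm : m < n) : W p m = p ⟨m, hm⟩ + W p (m + 1) := by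
  have h : p ⟨m, hm⟩ = ∑ t : Fin n, if t.val = m then p t else 0 := by
    rw [Finset.sum_eq_single ⟨m, hm⟩]
    · simp
    · intro t _ ht
      exact if_neg fun h => ht (Fin.ext h)
    · simp
  rw [h, W, W, ← Finset.sum_add_distrib]
  refine Finset.sum_congr rfl fun t _ => ?_
  rcases lt_trichotomy t.val m with h | h | h
  · simp [h.ne, show ¬ m ≤ t.val by omega, show ¬ m + 1 ≤ t.val by omega]
  · simp [h]
  · simp [h.ne', show m ≤ t.val by omega, show m + 1 ≤ t.val by omega]

theorem weightProg_spec (hn : 1 ≤ n) (hB : 3 * n * (2 * n) + 20 * n ≤ B) :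
    HaltsIn B weightProg (100 * n) (fun s => (s.reg 0 = n ∧ s.reg 1 = 1 ∧ s.reg 2 = 2 * n ∧
      s.reg 3 = 0 ∧ s.reg 4 = 3 * n) ∧ (∀ a i, s.word a i = 0) ∧
      ∀ m, s.real 3 m = (W p m : EReal)) (initState p) := by
  refine (haltsIn_instr_seq (t := n * 31 + 1 + 1 + 1 + 1 + 1) ?_ (haltsIn_instr_seq ?_
    (haltsIn_instr_seq ?_ (haltsIn_instr_seq (by trivial) (haltsIn_seq ?_))))).mono
    (fun _ h => h) (by omega)
  · simp only [Instr.Ok]; omega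
  · simp [Instr.Ok, Instr.eval, initState]; omega
  · simp [Instr.Ok, Instr.eval, initState]; omega
  refine (haltsIn_loop (fun s => ((s.reg 0 = n ∧ s.reg 1 = 1 ∧ s.reg 2 = 2 * n ∧
    s.reg 3 = 0 ∧ s.reg 4 = 3 * n) ∧ (∀ a i, s.word a i = 0) ∧
    ∀ m (hm : m < n), s.real 0 m = (p ⟨m, hm⟩ : EReal)) ∧ s.reg 6 ≤ n ∧
    ∀ m, s.reg 6 ≤ m → s.real 3 m = (W p m : EReal)) (fun s => s.reg 6) (t := 30) ?_ ?_
    (N := n) ?_).mono ?_ le_rfl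
  · rintro s ⟨⟨⟨h0, h1, h2, h3, h4⟩, hw, hp⟩, h6, hW⟩ hlt
    obtain ⟨j, hj⟩ : ∃ j, s.reg 6 = j + 1 := by
      simp only [Test.Holds] at hlt
      exact ⟨s.reg 6 - 1, by omega⟩
    rw [hj] at h6 hW
    refine (haltsIn_of_pre ?_).mono (fun _ h => h) (show Prog.time _ ≤ 30 by decide)
    simp [block, Prog.pre, Instr.Ok, Instr.eval, h0, h1, h2, h3, h4, hj, hw,
      hp j (by omega), hW (j + 1) le_rfl]
    refine ⟨hp, by omega, fun m hm => ?_⟩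
    by_cases h : m = j
    · subst h
      simp [W_eq_add (p := p) (show m < n by omega)]
    · simpa [h] using hW m (by omega)
  · refine ⟨⟨?_, ?_, ?_⟩, ?_⟩
    · simp [Instr.eval, initState]
      omega
    · simp [Instr.eval, initState]
    · intro m hm
      simp [Instr.eval, initState, hm]
    -- The cells from `n` on are initially 0, which is already the value of `W`.
    · simp [Instr.eval, initState]
      intro m hm
      simp [W_of_le hm]
  · simp [Instr.eval, initState]
  · rintro s ⟨⟨⟨h, hw, _⟩, _, hW⟩, hlt⟩
    simp only [Test.Holds, h.2.2.2.1] at hlt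
    exact haltsIn_block_nil ⟨h, hw, fun m => hW m (by omega)⟩

/-- Round `j` uses that `2j` and `2j + 1` have logarithm one more than `j`, and that `2j - 1` and
`2j` have rounded half `j`. The initial zeros supply the logarithms of 0 and 1. -/
theorem logProg_spec (hn : 1 ≤ n) (hB : 3 * n * (2 * n) + 20 * n ≤ B)
    (hs : (s.reg 0 = n ∧ s.reg 1 = 1 ∧ s.reg 2 = 2 * n ∧ s.reg 3 = 0 ∧ s.reg 4 = 3 * n) ∧
      (∀ a i, s.word a i = 0) ∧ ∀ m, s.real 3 m = (W p m : EReal)) :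
    HaltsIn B logProg (100 * n) (Ctx p) s := by
  refine (haltsIn_instr_seq (t := 2 * n * 31 + 1 + 1) ?_ (haltsIn_seq ?_)).mono
    (fun _ h => h) (by omega)
  · simp only [Instr.Ok]; omega
  refine (haltsIn_loop (fun s => ((s.reg 0 = n ∧ s.reg 1 = 1 ∧ s.reg 2 = 2 * n ∧
    s.reg 3 = 0 ∧ s.reg 4 = 3 * n) ∧ ∀ m, s.real 3 m = (W p m : EReal)) ∧
    (1 ≤ s.reg 6 ∧ s.reg 6 ≤ 2 * n) ∧ (∀ i < 2 * s.reg 6, s.word 2 i = Nat.log 2 i) ∧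
    ∀ i < 2 * s.reg 6 - 1, s.word 3 i = (i + 1) / 2)
    (fun s => 2 * n - s.reg 6) (t := 30) ?_ ?_ (N := 2 * n) (Nat.sub_le _ _)).mono ?_ le_rfl
  · clear hs
    rintro s ⟨⟨⟨h0, h1, h2, h3, h4⟩, hW⟩, ⟨h6, h6'⟩, hL, hH⟩ hlt
    obtain ⟨j, hj⟩ : ∃ j, s.reg 6 = j := ⟨_, rfl⟩
    simp only [Test.Holds, h2, hj] at hlt h6 h6' hL hH
    have hlog : Nat.log 2 j ≤ j := Nat.log_le_self 2 j
    refine (haltsIn_of_pre ?_).mono (fun _ h => h) (show Prog.time _ ≤ 30 by decide)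
    simp [block, Prog.pre, Instr.Ok, Instr.eval, h0, h1, h2, h3, h4, hj, hW,
      hL j (by omega)]
    refine ⟨by omega, by omega, by omega, by omega, ⟨by omega, ?_, ?_⟩, by omega⟩
    · intro i hi
      by_cases e1 : i = j + j + 1
      · subst e1
        simp [← two_mul, log_two_mul_add_one (show j ≠ 0 by omega)]
      · by_cases e2 : i = j + j
        · subst e2
          simp [← two_mul, log_two_mul (show j ≠ 0 by omega)]
        · simpa [e1, e2] using hL i (by omega)
    · intro i hi
      by_cases e1 : i = j + j
      · subst e1
        simp
        omega
      · by_cases e2 : i = j + j - 1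
        · subst e2
          simp
          omega
        · simpa [e1, e2] using hH i (by omega)
  · obtain ⟨⟨h0, h1, h2, h3, h4⟩, hw, hW⟩ := hs
    refine ⟨by simp [Instr.eval, h0, h1, h2, h3, h4, hW], by simp [Instr.eval]; omega, ?_, ?_⟩
    · intro i hi
      simp only [Instr.eval, State.setReg_reg, if_true, State.setReg_word, hw] at hi ⊢
      rw [Nat.log_of_lt (by omega)]
    · intro i hi
      simp only [Instr.eval, State.setReg_reg, if_true, State.setReg_word, hw] at hi ⊢
      omega
  · rintro s ⟨⟨⟨⟨h0, h1, h2, h3, h4⟩, hW⟩, ⟨_, h6⟩, hL, hH⟩, hlt⟩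
    simp only [Test.Holds, h2] at hlt
    exact haltsIn_block_nil ⟨h0, h1, h2, h3, h4, hW, fun i hi => hL i (by omega),
      fun i hi => hH i (by omega)⟩

theorem minProg_spec (hn : 1 ≤ n) (hB : 3 * n * (2 * n) + 20 * n ≤ B)
    (hs : Ctx p s ∧ Filled p (3 * n) 0 s) :
    HaltsIn B minProg (100 * n) (fun s => (Ctx p s ∧ Filled p (3 * n) 0 s) ∧
      s.reg 13 < 2 * n ∧ s.real 2 0 = OPT p n (s.reg 13) ∧
      ∀ b, 1 ≤ b → b ≤ 2 * n - 1 → OPT p n (s.reg 13) ≤ OPT p n b) s := by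
  have hm : n * (2 * n) ≤ 3 * n * (2 * n) := Nat.mul_le_mul_right _ (by omega)
  have h0 := hs.1.reg0
  have h1 := hs.1.reg1
  have h2 := hs.1.reg2
  have h3 := hs.1.reg3
  refine (haltsIn_instr_seq (t := 2 * n * 31 + 1 + 1 + 1 + 1 + 1 + 1) ?_ (haltsIn_instr_seq ?_
    (haltsIn_instr_seq ?_ (haltsIn_instr_seq (by trivial) (haltsIn_instr_seq ?_
      (haltsIn_seq ?_)))))).mono (fun _ h => h) (by omega)
  · simp only [Instr.Ok, h0, h2]; omega
  · simp [Instr.Ok, Instr.eval, h0, h1, h2]; omega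
  · simp only [Instr.Ok]; omega
  · simp only [Instr.Ok]; omega
  refine (haltsIn_loop (fun s => ((Ctx p s ∧ Filled p (3 * n) 0 s) ∧ s.reg 9 = n * (2 * n)) ∧
    (1 ≤ s.reg 6 ∧ s.reg 6 ≤ 2 * n) ∧ s.reg 13 < 2 * n ∧ s.real 2 0 = OPT p n (s.reg 13) ∧
    ∀ b, 1 ≤ b → b < s.reg 6 → OPT p n (s.reg 13) ≤ OPT p n b)
    (fun s => 2 * n - s.reg 6) (t := 30) ?_ ?_ (N := 2 * n) (Nat.sub_le _ _)).mono ?_ le_rfl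
  · clear h0 h1 h2 h3 hs
    rintro s ⟨⟨⟨hc, hT⟩, h9⟩, ⟨h6, h6'⟩, h13, hr, hmin⟩ hlt
    have h1 := hc.reg1
    have h2 := hc.reg2
    have h3 := hc.reg3
    obtain ⟨j, hj⟩ : ∃ j, s.reg 6 = j := ⟨_, rfl⟩
    simp only [Test.Holds, h2, hj] at hlt h6 h6' hmin
    refine (haltsIn_of_pre ?_).mono (fun _ h => h) (show Prog.time _ ≤ 30 by decide)
    simp [block, Prog.pre, Instr.Ok, Instr.eval, Test.Holds, h1, h3, h9, hj, hc, hT, hr, h13,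
      hlt, hT n j hlt (Or.inl (by omega))]
    refine ⟨by omega, fun hle => ⟨by omega, fun b hb hbj => ?_, by omega⟩,
      fun hle => ⟨by omega, fun b hb hbj => ?_, by omega⟩⟩
    · rcases hbj.lt_or_eq with h | rfl
      · exact hmin b hb h
      · exact hle
    · rcases hbj.lt_or_eq with h | rfl
      · exact hle.le.trans (hmin b hb h)
      · exact le_rfl
  · have hv : s.real 1 (n * (2 * n) + 1) = OPT p n 1 := hs.2 n 1 (by omega) (Or.inl (by omega))
    refine ⟨by simp [Instr.eval, hs, h0, h2], by simp [Instr.eval]; omega,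
      by simp [Instr.eval]; omega, by simp [Instr.eval, h0, h1, h2, h3, hv], ?_⟩
    intro b hb hb2
    simp [Instr.eval] at hb2 ⊢
    obtain rfl : b = 1 := by omega
    exact le_rfl
  · rintro s ⟨⟨⟨hs, h9⟩, ⟨_, h6⟩, h13, hr, hmin⟩, hlt⟩
    simp only [Test.Holds, hs.1.reg2] at hlt
    exact haltsIn_block_nil ⟨hs, h13, hr, fun b hb hb2 => hmin b hb (by omega)⟩

/-- The states agree up to registers 6 to 9, registers above 12 and real array 4. -/
structure Same (s₀ s : State) : Prop where
  reg : ∀ x, x < 6 ∨ 9 < x ∧ x < 13 → s.reg x = s₀.reg x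
  word : s.word = s₀.word
  real : ∀ a, a ≠ 4 → s.real a = s₀.real a

@[simp] theorem same_setReg {s₀ : State} {x k : ℕ} (hx : 5 < x) (hx' : x < 10 ∨ 12 < x) :
    Same s₀ (s.setReg x k) ↔ Same s₀ s := by
  have h : ∀ y, y < 6 ∨ 9 < y ∧ y < 13 → (s.setReg x k).reg y = s.reg y := fun y hy => by
    simp [show y ≠ x by omega]
  constructor <;> rintro ⟨h1, h2, h3⟩
  · exact ⟨fun y hy => by rw [← h y hy, h1 y hy], h2, h3⟩
  · exact ⟨fun y hy => by rw [h y hy, h1 y hy], h2, h3⟩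

@[simp] theorem same_setReal {s₀ : State} {i : ℕ} {r : EReal} :
    Same s₀ (s.setReal 4 i r) ↔ Same s₀ s := by
  have h : ∀ a, a ≠ 4 → (s.setReal 4 i r).real a = s.real a := fun a ha => by
    simp [State.setReal, ha]
  constructor <;> rintro ⟨h1, h2, h3⟩
  · exact ⟨h1, h2, fun a ha => by rw [← h a ha, h3 a ha]⟩
  · exact ⟨h1, h2, fun a ha => by rw [h a ha, h3 a ha]⟩

theorem Same.ctx {s₀ : State} (h : Same s₀ s) (hc : Ctx p s₀) : Ctx p s := by
  obtain ⟨h0, h1, h2, h3, h4, h5, h6, h7⟩ := hc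
  exact ⟨by rw [h.reg 0 (by omega), h0], by rw [h.reg 1 (by omega), h1],
    by rw [h.reg 2 (by omega), h2], by rw [h.reg 3 (by omega), h3],
    by rw [h.reg 4 (by omega), h4], by rwa [h.real 3 (by omega)], by rwa [h.word],
    by rwa [h.word]⟩

theorem Same.filled {s₀ : State} {j : ℕ} (h : Same s₀ s) (hT : Filled p d j s₀) :
    Filled p d j s := by
  rwa [Filled, h.real 1 (by omega)]

/-- `j` is a minimizer of the recurrence for the signature `(m, b)`. -/
def IsPredecessor (p : Fin n → ℝ) (m b j : ℕ) : Prop :=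
  (b ≤ 2 * j ∧ j ≤ b ∧ 2 * j ≤ m + b) ∧ gamma p (m + b) j ≤ OPT p m b

theorem scanProg_spec (hn : 1 ≤ n) (hB : 3 * n * (2 * n) + 20 * n ≤ B) {m b : ℕ}
    (hc : Ctx p s) (hT : Filled p (3 * n) 0 s) (h10 : s.reg 10 = m) (h11 : s.reg 11 = b)
    (h5 : s.reg 5 = m + b) (hd : 2 ≤ m + b) (hm : m ≤ n) (hb : b < 2 * n)
    (htop : OPT p m b ≠ ⊤) :
    HaltsIn B scanProg (100 * n) (fun s' => Same s s' ∧ IsPredecessor p m b (s'.reg 13)) s := by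
  have h2 := hc.reg2
  have hmn : m * (2 * n) ≤ 3 * n * (2 * n) := Nat.mul_le_mul_right _ (by omega)
  refine (haltsIn_instr_seq (t := 2 * n * 31 + 1 + 1 + 1 + 1) ?_ (haltsIn_instr_seq ?_
    (haltsIn_instr_seq ?_ (haltsIn_seq ?_)))).mono (fun _ h => h) (by omega)
  · simp only [Instr.Ok, h10, h2]; omega
  · simp [Instr.Ok, Instr.eval, h10, h11, h2]; omega
  · simp only [Instr.Ok]; omega
  -- The invariant is conditional: register 13 holds a minimizer if one has been passed. That one
  -- exists is supplied only after the loop, by `exists_eq_gamma`.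
  refine (haltsIn_loop (fun s' => (Same s s' ∧ s'.reg 9 = m * (2 * n) + b) ∧
    (1 ≤ s'.reg 6 ∧ s'.reg 6 ≤ 2 * n) ∧ ∀ j, 1 ≤ j → j < s'.reg 6 → IsPredecessor p m b j →
      IsPredecessor p m b (s'.reg 13))
    (fun s' => 2 * n - s'.reg 6) (t := 30) ?_ ?_ (N := 2 * n) (Nat.sub_le _ _)).mono ?_ le_rfl
  · rintro s' ⟨⟨hs, h9⟩, ⟨h6, h6'⟩, hr⟩ hlt
    have h1 : s'.reg 1 = 1 := (hs.ctx hc).reg1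
    have h3 : s'.reg 3 = 0 := (hs.ctx hc).reg3
    rw [← hs.reg 2 (by omega)] at h2
    rw [← hs.reg 5 (by omega)] at h5
    rw [← hs.reg 11 (by omega)] at h11
    have hW := (hs.ctx hc).weight
    have hT' := hs.filled hT
    obtain ⟨j, hj⟩ : ∃ j, s'.reg 6 = j := ⟨_, rfl⟩
    simp only [Test.Holds, h2, hj] at hlt h6 h6' hr
    have hmj : (m + b - (j + j)) * (2 * n) ≤ 3 * n * (2 * n) :=
      Nat.mul_le_mul_right _ (by omega)
    have hnot : ∀ r, ¬ IsPredecessor p m b j → ∀ i, 1 ≤ i → i ≤ j →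
        IsPredecessor p m b i → (∀ i, 1 ≤ i → i < j → IsPredecessor p m b i →
        IsPredecessor p m b r) → IsPredecessor p m b r := by
      intro r hj i hi hij hP hr
      rcases hij.lt_or_eq with h | rfl
      · exact hr i hi h hP
      · exact absurd hP hj
    have hg : j + j ≤ m + b → s'.real 1 ((m + b - (j + j)) * (2 * n) + j) +
        (W p (m + b - (j + j)) : EReal) = gamma p (m + b) j := fun h => by
      rw [hT' _ _ hlt (Or.inl (by omega)), gamma, two_mul]
    have hv := hT' m b hb (Or.inl (by omega))
    refine (haltsIn_of_pre ?_).mono (fun _ h => h) (show Prog.time _ ≤ 30 by decide)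
    simp [block, Prog.pre, Instr.Ok, Instr.eval, Test.Holds, h1, h2, h3, h5, h9, h11, hj, hs, hW,
      hv]
    refine ⟨by omega, fun hbj => ⟨by omega, ⟨by omega, fun i hi hij hP => ?_⟩, by omega⟩,
      fun hbj => ⟨fun hjb => ⟨by omega, ⟨by omega, fun i hi hij hP => ?_⟩, by omega⟩,
      fun hjb => ⟨fun hjd => ⟨by omega, ⟨by omega, fun i hi hij hP => ?_⟩, by omega⟩,
      fun hjd => ⟨by omega, by omega,
        fun hle => ⟨by omega, ⟨by omega, fun i hi hij hP => ?_⟩, by omega⟩,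
        fun hle => ⟨by omega, ⟨by omega, fun i hi hij hP => ?_⟩, by omega⟩⟩⟩⟩⟩
    · exact hnot _ (fun h => by have := h.1; omega) i hi hij hP hr
    · exact hnot _ (fun h => by have := h.1; omega) i hi hij hP hr
    · exact hnot _ (fun h => by have := h.1; omega) i hi hij hP hr
    · exact ⟨by omega, (hg hjd).symm.le.trans hle⟩
    · refine hnot _ (fun h => ?_) i hi hij hP hr
      rw [hg hjd] at hle
      exact absurd h.2 (not_le.2 hle)
  · refine ⟨⟨?_, by simp [Instr.eval, h10, h11, h2]⟩, by simp [Instr.eval]; omega, ?_⟩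
    · simp only [Instr.eval]
      rw [same_setReg (by omega) (by omega), same_setReg (by omega) (by omega),
        same_setReg (by omega) (by omega)]
      exact ⟨fun _ _ => rfl, rfl, fun _ _ => rfl⟩
    · intro j hj hj'
      simp [Instr.eval] at hj'
      omega
  · rintro s' ⟨⟨⟨hs, _⟩, ⟨_, h6⟩, hr⟩, hlt⟩
    simp only [Test.Holds, (hs.ctx hc).reg2] at hlt
    obtain ⟨j, hj, hle⟩ := exists_eq_gamma hd htop
    have hb0 : b ≠ 0 := by
      rintro rfl
      exact htop (OPT_bad_zero m)
    exact haltsIn_block_nil ⟨hs, hr j (by omega) (by omega) ⟨hj, hle⟩⟩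

/-- The invariant of the search for a minimum-cost tree: the signature in registers 10 and 11 is
the last one of a sequence that starts with `(n, r)`. -/
structure BackInv (p : Fin n → ℝ) (r : ℕ) (s : State) : Prop where
  ctx : Ctx p s
  filled : Filled p (3 * n) 0 s
  min : s.real 2 0 = OPT p n r
  sum : s.reg 5 = s.reg 10 + s.reg 11
  lt : s.reg 12 + s.reg 5 < 3 * n
  le : s.reg 10 ≤ n
  lt_row : s.reg 11 < 2 * n
  ne_top : OPT p (s.reg 10) (s.reg 11) ≠ ⊤
  first : s.word 4 0 = n ∧ s.word 5 0 = r
  last : s.word 4 (s.reg 12) = s.reg 10 ∧ s.word 5 (s.reg 12) = s.reg 11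
  step : ∀ i < s.reg 12,
    Expansion (s.word 4 (i + 1), s.word 5 (i + 1)) (s.word 4 i, s.word 5 i) ∧
      OPT p (s.word 4 (i + 1)) (s.word 5 (i + 1)) + (W p (s.word 4 (i + 1)) : EReal) ≤
        OPT p (s.word 4 i) (s.word 5 i)

/-- Going back replaces `m + b` by `m + b - b'` with `b' ≥ 1`, so the step counter plus `m + b`
never grows. The predecessor's entry is finite because adding `W` to it gives at most a finite
entry. -/
theorem BackInv.step_spec {r : ℕ} (hn : 1 ≤ n) (hB : 3 * n * (2 * n) + 20 * n ≤ B)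
    (h : BackInv p r s) (hlt : 1 < s.reg 5) :
    HaltsIn B (block [scanProg, add 7 13 13, sub 10 5 7, move 11 13, add 12 12 1,
      store 4 12 10, store 5 12 11, add 5 10 11]) (100 * n + 30)
      (fun s' => BackInv p r s' ∧ s'.reg 5 < s.reg 5) s := by
  have hsum := h.sum
  refine haltsIn_seq ((scanProg_spec hn hB h.ctx h.filled rfl rfl h.sum (by omega) h.le h.lt_row
    h.ne_top).mono ?_ le_rfl)
  rintro s₁ ⟨hs, hP⟩
  have h1 : s₁.reg 1 = 1 := (hs.ctx h.ctx).reg1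
  have hc := hs.ctx h.ctx
  have hT := hs.filled h.filled
  have h2 : s₁.real 2 0 = OPT p n r := by rw [hs.real 2 (by omega), h.min]
  obtain ⟨m, hm⟩ : ∃ m, s.reg 10 = m := ⟨_, rfl⟩
  obtain ⟨b, hb⟩ : ∃ b, s.reg 11 = b := ⟨_, rfl⟩
  obtain ⟨l, hl⟩ : ∃ l, s.reg 12 = l := ⟨_, rfl⟩
  obtain ⟨j, hj⟩ : ∃ j, s₁.reg 13 = j := ⟨_, rfl⟩
  have h5 : s₁.reg 5 = m + b := by rw [hs.reg 5 (by omega), h.sum, hm, hb]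
  have h12 : s₁.reg 12 = l := by rw [hs.reg 12 (by omega), hl]
  have hmn := h.le
  have hbn := h.lt_row
  have hln := h.lt
  have htop := h.ne_top
  obtain ⟨hw4, hw5⟩ := h.first
  obtain ⟨hl4, hl5⟩ := h.last
  have hstep := h.step
  rw [← hs.word] at hw4 hw5 hl4 hl5 hstep
  rw [hm, hb, hj] at hP
  rw [h.sum, hm, hb] at hlt
  rw [h.sum, hm, hb, hl] at hln
  rw [hm] at hmn hl4
  rw [hb] at hbn hl5
  rw [hm, hb] at htop
  rw [hl] at hl4 hl5 hstep
  obtain ⟨⟨hj1, hj2, hj3⟩, hg⟩ := hP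
  have hj0 : j ≠ 0 := by
    rintro rfl
    obtain rfl : b = 0 := by omega
    exact htop (OPT_bad_zero m)
  rw [gamma] at hg
  refine (haltsIn_of_pre ?_).mono (fun _ h => h) (show Prog.time _ ≤ 30 by decide)
  simp [block, Prog.pre, Instr.Ok, Instr.eval, h1, h5, h12, hj, hsum, hm, hb]
  refine ⟨by omega, by omega, by omega, ?_, by omega⟩
  constructor
  · simp [hc]
  · simp [hT]
  · simpa using h2
  · simp
  · simp
    omega
  · simp
    omega
  · simp
    omega
  · simp
    rw [← two_mul]
    intro htop'
    rw [htop', EReal.top_add_coe, top_le_iff] at hg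
    exact htop hg
  · simp [hw4, hw5]
  · simp
  · intro i hi
    simp at hi
    rcases hi.lt_or_eq with h | rfl
    · simpa [h.ne, show i ≠ l + 1 by omega] using hstep i h
    · simp [hl4, hl5]
      rw [← two_mul]
      exact ⟨by simp only [Expansion]; omega, hg⟩

theorem backProg_spec (hn : 1 ≤ n) (hB : 3 * n * (2 * n) + 20 * n ≤ B) {r : ℕ}
    (hc : Ctx p s) (hT : Filled p (3 * n) 0 s) (h13 : s.reg 13 = r) (hr : r < 2 * n)
    (hmin : s.real 2 0 = OPT p n r) (htop : OPT p n r ≠ ⊤) :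
    HaltsIn B backProg (1000 * n ^ 2) (fun s => BackInv p r s ∧ s.word 4 (s.reg 12) = 0 ∧
      s.word 5 (s.reg 12) = 1) s := by
  have hn2 : n ≤ n ^ 2 := Nat.le_self_pow two_ne_zero n
  have h0 := hc.reg0
  refine (haltsIn_instr_seq (t := 3 * n * (100 * n + 30 + 1) + 1 + 1 + 1 + 1 + 1 + 1 + 1)
    (by trivial) (haltsIn_instr_seq (by trivial) (haltsIn_instr_seq ?_
    (haltsIn_instr_seq (by trivial) (haltsIn_instr_seq (by trivial) (haltsIn_instr_seq ?_
    (haltsIn_seq ?_))))))).mono (fun _ h => h) (by nlinarith)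
  · simp [Instr.Ok]
  · simp [Instr.Ok, Instr.eval, h0, h13]
    omega
  refine (haltsIn_loop (BackInv p r) (fun s => s.reg 5) (t := 100 * n + 30) ?_ ?_
    (N := 3 * n) ?_).mono ?_ le_rfl
  · intro s hs hlt
    simp only [Test.Holds, hs.ctx.reg1] at hlt
    exact hs.step_spec hn hB hlt
  · simp only [Instr.eval]
    constructor
    · simp [hc]
    · simp [hT]
    · simp [hmin]
    · simp
    · simp [h0, h13]
      omega
    · simp [h0]
    · simp [h13, hr]
    · simp [h0, h13, htop]
    · simp [h0, h13]
    · simp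
    · simp
  · simp [Instr.eval, h0, h13]
    omega
  · rintro s ⟨hs, hlt⟩
    simp only [Test.Holds, hs.ctx.reg1, hs.sum] at hlt
    refine haltsIn_block_nil ⟨hs, ?_⟩
    -- At the exit `m + b ≤ 1`, and a finite entry has `b ≠ 0`; only `(0, 1)` remains.
    have h11 : s.reg 11 ≠ 0 := fun h => hs.ne_top (h ▸ OPT_bad_zero _)
    rw [hs.last.1, hs.last.2]
    omega

theorem reverseProg_spec {l : ℕ} (hn : 1 ≤ n) (hB : 3 * n * (2 * n) + 20 * n ≤ B)
    (h1 : s.reg 1 = 1) (h12 : s.reg 12 = l) (hl : l < 3 * n) :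
    HaltsIn B reverseProg (200 * n) (fun s' => s'.reg 0 = l ∧ s'.real = s.real ∧
      ∀ i ≤ l, s'.word 0 i = s.word 4 (l - i) ∧ s'.word 1 i = s.word 5 (l - i)) s := by
  refine (haltsIn_instr_seq (t := 3 * n * 31 + 1 + 2 + 1) ?_ (haltsIn_instr_seq ?_
    (haltsIn_seq ?_))).mono (fun _ h => h) (by omega)
  · simp [Instr.Ok]
  · simp [Instr.Ok, Instr.eval, h12, h1]
    omega
  refine (haltsIn_loop (fun s' => ((s'.reg 1 = 1 ∧ s'.reg 7 = l + 1 ∧ s'.reg 12 = l) ∧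
    s'.real = s.real ∧ (∀ i, s'.word 4 i = s.word 4 i) ∧ ∀ i, s'.word 5 i = s.word 5 i) ∧
    s'.reg 6 ≤ l + 1 ∧
    ∀ i < s'.reg 6, s'.word 0 i = s.word 4 (l - i) ∧ s'.word 1 i = s.word 5 (l - i))
    (fun s' => l + 1 - s'.reg 6) (t := 30) ?_ ?_ (N := 3 * n) ?_).mono ?_ le_rfl
  · rintro s' ⟨⟨⟨h1, h7, h12⟩, hr, h4, h5⟩, h6, hw⟩ hlt
    obtain ⟨j, hj⟩ : ∃ j, s'.reg 6 = j := ⟨_, rfl⟩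
    simp only [Test.Holds, h7, hj] at hlt h6 hw
    refine (haltsIn_of_pre ?_).mono (fun _ h => h) (show Prog.time _ ≤ 30 by decide)
    simp [block, Prog.pre, Instr.Ok, Instr.eval, h1, h7, h12, hj, hr, h4, h5]
    refine ⟨by omega, ⟨by omega, fun i hi => ?_⟩, by omega⟩
    rcases hi.lt_or_eq with h | rfl
    · simpa [h.ne] using hw i h
    · simp
  · simp [Instr.eval, h1, h12]
  · exact (Nat.sub_le _ _).trans hl
  · rintro s' ⟨⟨⟨⟨_, h7, h12⟩, hr, _, _⟩, h6, hw⟩, hlt⟩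
    simp only [Test.Holds, h7] at hlt
    refine (haltsIn_of_pre ?_).mono (fun _ h => h) (show Prog.time _ ≤ 2 by decide)
    simp [block, Prog.pre, Instr.Ok, Instr.eval, h12, hr]
    exact fun i hi => hw i (by omega)

theorem isOutput_of_backInv (hn : 1 ≤ n) (hp : ∀ t, 0 ≤ p t) (hpa : Antitone p) {r l : ℕ}
    {s s' : State} (hr : r < 2 * n)
    (hmin : ∀ b, 1 ≤ b → b ≤ 2 * n - 1 → OPT p n r ≤ OPT p n b)
    (h : BackInv p r s) (hl : s.reg 12 = l) (h4 : s.word 4 l = 0) (h5 : s.word 5 l = 1)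
    (hl' : s'.reg 0 = l) (hreal : s'.real = s.real)
    (hw : ∀ i ≤ l, s'.word 0 i = s.word 4 (l - i) ∧ s'.word 1 i = s.word 5 (l - i)) :
    IsOutput p s' := by
  subst hl'
  have hw0 : s'.word 0 0 = 0 := by rw [(hw 0 (by omega)).1, Nat.sub_zero, h4]
  have hw1 : s'.word 1 0 = 1 := by rw [(hw 0 (by omega)).2, Nat.sub_zero, h5]
  have hwn : s'.word 0 (s'.reg 0) = n := by rw [(hw _ le_rfl).1, Nat.sub_self, h.first.1]
  have hwr : s'.word 1 (s'.reg 0) = r := by rw [(hw _ le_rfl).2, Nat.sub_self, h.first.2]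
  have hstep : ∀ i < s'.reg 0,
      Expansion (s'.word 0 i, s'.word 1 i) (s'.word 0 (i + 1), s'.word 1 (i + 1)) ∧
      OPT p (s'.word 0 i) (s'.word 1 i) + (W p (s'.word 0 i) : EReal) ≤
        OPT p (s'.word 0 (i + 1)) (s'.word 1 (i + 1)) := by
    intro i hi
    have := h.step (s'.reg 0 - (i + 1)) (by omega)
    rw [show s'.reg 0 - (i + 1) + 1 = s'.reg 0 - i by omega] at this
    rwa [(hw i hi.le).1, (hw i hi.le).2, (hw (i + 1) hi).1, (hw (i + 1) hi).2]
  obtain ⟨T, hT, hTi⟩ := exists_tree_of_chain hp hw0 hw1 hwn hwr hstep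
  refine ⟨fun m b hmb => ?_, T, isOptimalCode_of_OPT hn hp hpa T hT hmin, ?_, hTi, hw0, hw1, hwn,
    ?_⟩
  · obtain ⟨hm, hb⟩ := hmb
    simp only at hm hb
    rw [hreal]
    exact h.filled m b (by omega) (Or.inl (by omega))
  · rw [hreal, h.min, ← hT, T.partialCost_eq_cost]
  -- Validity is carried from the final signature `(n, r)` back towards level 0, since both
  -- components can only decrease that way.
  · have hv : ∀ k ≤ s'.reg 0, Valid n (s'.word 0 (s'.reg 0 - k), s'.word 1 (s'.reg 0 - k)) := by
      intro k
      induction k with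
      | zero =>
        intro _
        rw [Nat.sub_zero, hwn, hwr]
        exact ⟨le_rfl, by simp only; omega⟩
      | succ k ih =>
        intro hk
        obtain ⟨h1, h2⟩ := ih (by omega)
        have hE := (hstep (s'.reg 0 - (k + 1)) (by omega)).1
        rw [show s'.reg 0 - (k + 1) + 1 = s'.reg 0 - k by omega] at hE
        exact ⟨hE.1.trans h1, hE.2.2.2.trans h2⟩
    intro i hi
    rw [expands_iff]
    · exact (hstep i hi).1
    · have := hv (s'.reg 0 - (i + 1)) (by omega)
      rwa [show s'.reg 0 - (s'.reg 0 - (i + 1)) = i + 1 by omega] at this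

theorem mainProg_spec (hn : 1 ≤ n) (hB : 3 * n * (2 * n) + 20 * n ≤ B) (hp : ∀ t, 0 ≤ p t)
    (hpa : Antitone p) :
    HaltsIn B mainProg (4000 * n ^ 2) (IsOutput p) (initState p) := by
  have hn2 : n ≤ n ^ 2 := Nat.le_self_pow two_ne_zero n
  refine (haltsIn_seq (t' := 3000 * n ^ 2 + 400 * n + 1)
    ((weightProg_spec hn hB).mono (fun s hs => ?_) le_rfl)).mono (fun _ h => h) (by omega)
  refine (haltsIn_seq (t' := 3000 * n ^ 2 + 300 * n + 1)
    ((logProg_spec hn hB hs).mono (fun s hs => ?_) le_rfl)).mono (fun _ h => h) (by omega)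
  refine (haltsIn_seq (t' := 1000 * n ^ 2 + 300 * n + 1)
    ((tableProg_spec hn hB hp hs).mono (fun s hs => ?_) le_rfl)).mono (fun _ h => h) (by omega)
  refine (haltsIn_seq (t' := 1000 * n ^ 2 + 200 * n + 1)
    ((minProg_spec hn hB hs).mono ?_ le_rfl)).mono (fun _ h => h) (by omega)
  rintro s ⟨⟨hc, hT⟩, hr, hreal, hmin⟩
  refine (haltsIn_seq (t' := 200 * n + 1)
    ((backProg_spec hn hB hc hT rfl hr hreal (OPT_ne_top_of_min hn hp hpa hmin)).mono ?_
      le_rfl)).mono (fun _ h => h) (by omega)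
  rintro s₁ ⟨hs₁, h4, h5⟩
  have hlt := hs₁.lt
  refine haltsIn_seq ((reverseProg_spec hn hB hs₁.ctx.reg1 rfl (by omega)).mono ?_ le_rfl)
  rintro s₂ ⟨h0, hr₂, hw⟩
  exact haltsIn_block_nil
    (isOutput_of_backInv hn hp hpa hr hmin hs₁ rfl h4 h5 h0 hr₂ hw)

end Correctness

end OneEnded

/-! ### The main theorem -/

theorem mainTheorem5 :
    (∀ (n : ℕ) (_ : 1 ≤ n) (p : Fin n → ℝ) (_ : ∀ t, 0 ≤ p t) (_ : Antitone p),
      -- some optimal tree is sorted by depth and satisfies the structural conditions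
      (∃ (T : OneEnded.CodeTree) (v : Fin n → List Bool),
        OneEnded.IsOptimalCode p v ∧ T.Labels v ∧
        (∀ w, T.IsLeaf w → OneEnded.EndsIn true w → w ∉ Set.range v →
          ∀ t, (v t).length ≤ w.length) ∧
        T.Structural n) ∧
      -- for such trees all truncations have valid signatures
      (∀ (T : OneEnded.CodeTree) (v : Fin n → List Bool), T.Labels v →
        (∀ w, T.IsLeaf w → OneEnded.EndsIn true w → w ∉ Set.range v →
          ∀ t, (v t).length ≤ w.length) →
        T.Structural n →
        (∀ i ≤ T.height, T.badAt v i ≤ 2 * n - 1) ∧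
        (2 ≤ n → T.badAt v T.height ≤ 2 * n - 2)) ∧
      -- the minimum in the definition of a table entry is attained
      (∀ m b, OneEnded.Valid n (m, b) → OneEnded.OPT p m b ≠ ⊤ →
        ∃ (i : ℕ) (T : OneEnded.PartialTree i m), T.bad = b ∧
          OneEnded.OPT p m b = (T.partialCost p : EReal)) ∧
      -- the recurrence
      OneEnded.OPT p 0 1 = 0 ∧
      (∀ m b, OneEnded.Valid n (m, b) → (m, b) ≠ (0, 1) →
        OneEnded.OPT p m b =
          ⨅ (q : ℕ × ℕ) (_ : OneEnded.Expands n q (m, b)),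
            (OneEnded.OPT p q.1 q.2 + (OneEnded.W p q.1 : EReal))) ∧
      -- the optimum is read off the row `m = n`
      (∀ v : Fin n → List Bool, OneEnded.IsOptimalCode p v →
        (OneEnded.cost p v : EReal) =
            ⨅ b ∈ Finset.Icc 1 (2 * n - 1), OneEnded.OPT p n b ∧
        (2 ≤ n → (OneEnded.cost p v : EReal) =
            ⨅ b ∈ Finset.Icc 1 (2 * n - 2), OneEnded.OPT p n b)) ∧
      -- the entries with `m + b = d` are range minima of `γ` over `b / 2 ≤ b' ≤ b`
      (∀ d m b, 2 ≤ d → OneEnded.Valid n (m, b) → 0 < b → m + b = d →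
        OneEnded.OPT p m b =
          ⨅ (b' : ℕ) (_ : b ≤ 2 * b' ∧ b' ≤ b ∧ 2 * b' ≤ d), OneEnded.gamma p d b')) ∧
    -- one program fills in the table and finds an optimal tree in `O(n ^ 2)` steps
    (∃ (P : OneEnded.Prog) (C K : ℕ),
      ∀ (n : ℕ) (_ : 1 ≤ n) (p : Fin n → ℝ) (_ : ∀ t, 0 ≤ p t) (_ : Antitone p),
        ∃ (t : ℕ) (s : OneEnded.State),
          OneEnded.Exec (K * n ^ 2) P (OneEnded.initState p) t s ∧ t ≤ C * n ^ 2 ∧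
          OneEnded.IsOutput p s) := by

  refine ⟨fun n hn p hp hpa => ⟨OneEnded.exists_structural_isOptimalCode hn hp hpa, ?_, ?_,
    OneEnded.OPT_zero_one hp, ?_, fun v hv => hv.cost_eq_iInf hn hp hpa, ?_⟩,
    OneEnded.mainProg, 4000, 100, fun n hn p hp hpa => ?_⟩
  · intro T v hv hs hT
    exact ⟨fun i hi => hT.badAt_le hn hv hs hi, fun h2 => hT.badAt_height_le h2 hv hs⟩
  · exact fun m b _ h => OneEnded.exists_eq_OPT h
  · intro m b hv h
    simp only [OneEnded.expands_iff hv]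
    exact OneEnded.OPT_eq_iInf h
  · exact fun d m b hd _ hb h => OneEnded.OPT_eq_iInf_gamma hd hb h
  -- The word bound suffices because `6n² + 20n ≤ 100n²` for `n ≥ 1`.
  · obtain ⟨t, s, he, ht, hs⟩ := OneEnded.mainProg_spec hn (B := 100 * n ^ 2) (by nlinarith) hp hpa
    exact ⟨t, s, he, ht, hs⟩
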